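/- Let $\mathbf A$ be the finite relation algebra with four atoms $\mathrm{id},a,b,c$, all symmetric, in which a triple $(x,y,z)\in\{a,b,c\}^3$ of diversity atoms is allowed (that is, $z\le x\circ y$) if and only if $x,y,z$ are not pairwise distinct; triples containing $\mathrm{id}$ are allowed exactly when the identity law forces it: $(\mathrm{id},x,x)$, $(x,\mathrm{id},x)$ and $(x,x,\mathrm{id})$ for every atom $x$. (This is the algebra $24_{65}$ in Maddux's list.) The elements of $\mathbf A$ are the 16 sets of atoms. An $\mathbf A$-network consists of a finite set $V$ and a function $f\colon V^2\to A$. It is satisfiable if there are a representation $\mathfrak B$ of $\mathbf A$ (a set $B$ together with an interpretation of the elements of $\mathbf A$ by binary relations on $B$ such that $0$ is empty, $1$ is the union of all the relations, $\mathrm{id}$ is equality on $B$, complement is taken relative to $1$, and union, converse and composition are the set-theoretic ones) and a map $s\colon V\to B$ with $(s(x),s(y))\in f(x,y)^{\mathfrak B}$ for all $x,y\in V$. The network satisfaction problem $\mathrm{NSP}(\mathbf A)$ is to decide whether a given $\mathbf A$-network is satisfiable. **Proposition.** $\mathrm{NSP}(\mathbf A)$ is in $\mathrm P$. More precisely, it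 can be decided in time $O(n^2)$ by a deterministic multi-tape (multi-stack) Turing machine, where $n$ is the size of the input, that is, the length of the word that lists the $|V|\times|V|$ matrix of labels row by row, with a marker at the end of each row. -/

import Mathlib

universe u v

/-! ### Relation algebras, representations, networks -/

/-- Relation algebras: a Boolean algebra together with an identity element, a converse operation
and a composition. -/
class RelationAlgebra (A : Type v) extends BooleanAlgebra A where
  /-- the identity element -/
  ident : A
  /-- the converse -/
  conv : A → A
  /-- the composition -/
  comp : A → A → A
  comp_assoc : ∀ x y z : A, comp (comp x y) z = comp x (comp y z)
  sup_comp : ∀ x y z : A, comp (x ⊔ y) z = comp x z ⊔ comp y z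
  comp_ident : ∀ x : A, comp x ident = x
  conv_conv : ∀ x : A, conv (conv x) = x
  conv_sup : ∀ x y : A, conv (x ⊔ y) = conv x ⊔ conv y
  conv_comp : ∀ x y : A, conv (comp x y) = comp (conv y) (conv x)
  compl_sup_conv_comp : ∀ x y : A, yᶜ ⊔ comp (conv x) (comp x y)ᶜ = yᶜ

/-- A representation of the relation algebra `A` with domain `B` (which may be empty). It need not
be square: the element `⊤` is not required to denote all of `B × B`. -/
structure AlgebraRepresentation (A : Type v) [RelationAlgebra A] (B : Type u) where
  /-- the binary relation denoted by an element of the algebra -/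
  rel : A → Set (B × B)
  rel_bot : rel ⊥ = ∅
  rel_top : rel ⊤ = ⋃ x, rel x
  rel_ident : rel RelationAlgebra.ident = {p | p.1 = p.2}
  rel_compl : ∀ x, rel xᶜ = rel ⊤ \ rel x
  rel_conv : ∀ x, rel (RelationAlgebra.conv x) = {p | (p.2, p.1) ∈ rel x}
  rel_sup : ∀ x y, rel x ∪ rel y = rel (x ⊔ y)
  rel_comp : ∀ x y,
    {p | ∃ w, (p.1, w) ∈ rel x ∧ (w, p.2) ∈ rel y} = rel (RelationAlgebra.comp x y)

/-- A network over `A`: finitely many variables (numbered `0, …, size - 1`), and a label in `A` for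
every ordered pair of variables. -/
structure Network (A : Type v) where
  /-- the number of variables -/
  size : ℕ
  /-- the labels -/
  label : Fin size → Fin size → A

/-- A network is satisfiable if the algebra has some representation in whose domain the variables
can be assigned values that respect all labels. -/
def Network.Satisfiable {A : Type v} [RelationAlgebra A] (N : Network A) : Prop :=
  ∃ (B : Type u) (R : AlgebraRepresentation A B) (s : Fin N.size → B),
    ∀ x y, (s x, s y) ∈ R.rel (N.label x y)

/-- The input word of a network: its matrix of labels, row by row, where `none` marks the end of
every row. For a network with `m` variables it has length `m ^ 2 + m`. -/
def Network.encode {A : Type v} (N : Network A) : List (Option A) :=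
  (List.finRange N.size).flatMap fun x =>
    (List.finRange N.size).map (fun y => some (N.label x y)) ++ [none]

open Classical in
/-- The network satisfaction problem of `A`, as a function from instances to answers. -/
noncomputable def networkSatisfaction (A : Type v) [RelationAlgebra A] : Network A → Bool :=
  fun N => decide (Network.Satisfiable.{u} N)

/-! ### The relation algebra with three symmetric diversity atoms and no rainbow triangle -/

/-- The atoms: the identity atom `e` and three diversity atoms. -/
inductive Atom : Type
  | e | a | b | c
  deriving DecidableEq

namespace Atom

instance : Fintype Atom where
  elems := {e, a, b, c}
  complete := by intro x; cases x <;> decide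

/-- The allowed triples `(x, y, z)`, meaning that `z` lies below the composition of `x` and `y`.
Triples that contain the identity atom are as they must be when all atoms are symmetric. A triple of
diversity atoms is allowed if and only if it is not a rearrangement of `(a, b, c)`. -/
def Allowed (x y z : Atom) : Prop :=
  (x = e ∧ y = z) ∨ (y = e ∧ x = z) ∨ (z = e ∧ x = y) ∨
    (x ≠ e ∧ y ≠ e ∧ z ≠ e ∧ (x = y ∨ y = z ∨ x = z))

instance (x y z : Atom) : Decidable (Allowed x y z) := by
  unfold Allowed; infer_instance

theorem allowed_assoc : ∀ x y z t : Atom,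
    (∃ w, Allowed x y w ∧ Allowed w z t) ↔ ∃ w, Allowed y z w ∧ Allowed x w t := by
  decide

theorem allowed_comm : ∀ x y z : Atom, Allowed x y z ↔ Allowed y x z := by
  decide

theorem allowed_rotate : ∀ x y z : Atom, Allowed x y z ↔ Allowed x z y := by
  decide

theorem allowed_e : ∀ x z : Atom, Allowed x e z ↔ x = z := by
  decide

end Atom

/-- The relation algebra whose elements are the sets of atoms. Every element is its own converse,
and composition is determined by the allowed triples. -/
instance rainbowFreeAlgebra : RelationAlgebra (Finset Atom) where
  ident := {Atom.e}
  conv X := X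
  comp X Y := Finset.univ.filter fun z => ∃ x ∈ X, ∃ y ∈ Y, Atom.Allowed x y z
  comp_assoc X Y Z := by
    ext t
    simp only [Finset.mem_filter, Finset.mem_univ, true_and]
    constructor
    · rintro ⟨w, ⟨x, hx, y, hy, h1⟩, z, hz, h2⟩
      obtain ⟨w', h3, h4⟩ := (Atom.allowed_assoc x y z t).1 ⟨w, h1, h2⟩
      exact ⟨x, hx, w', ⟨y, hy, z, hz, h3⟩, h4⟩
    · rintro ⟨x, hx, w, ⟨y, hy, z, hz, h1⟩, h2⟩
      obtain ⟨w', h3, h4⟩ := (Atom.allowed_assoc x y z t).2 ⟨w, h1, h2⟩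
      exact ⟨w', ⟨x, hx, y, hy, h3⟩, z, hz, h4⟩
  sup_comp X Y Z := by
    ext t
    simp only [Finset.mem_filter, Finset.mem_univ, true_and, Finset.sup_eq_union,
      Finset.mem_union, or_and_right, exists_or]
  comp_ident X := by
    ext t
    simp [Atom.allowed_e]
  conv_conv _ := rfl
  conv_sup _ _ := rfl
  conv_comp X Y := by
    ext t
    simp only [Finset.mem_filter, Finset.mem_univ, true_and]
    constructor
    · rintro ⟨x, hx, y, hy, h⟩
      exact ⟨y, hy, x, hx, (Atom.allowed_comm x y t).1 h⟩
    · rintro ⟨y, hy, x, hx, h⟩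
      exact ⟨x, hx, y, hy, (Atom.allowed_comm y x t).1 h⟩
  compl_sup_conv_comp X Y := by
    rw [sup_eq_left]
    intro t ht
    simp only [Finset.mem_filter, Finset.mem_univ, true_and, Finset.mem_compl] at ht ⊢
    obtain ⟨x, hx, y, hy, h⟩ := ht
    intro htY
    exact hy ⟨x, hx, t, htY, (Atom.allowed_rotate x y t).1 h⟩

/-! ### Complexity, measured on deterministic machines with finitely many stacks -/

open Turing Computability

/-- The decision problem `f` is in P, for inputs that are presented by the encoding `enc`. -/
def InPolyTime {α Γ : Type} (enc : α → List Γ) (f : α → Bool) : Prop :=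
  Nonempty (TM2ComputableInPolyTime enc encodeBool f)

/-- The decision problem `f` is decided by one machine within a number of steps in `O(n ^ 2)`, where
`n` is the length of the input word. -/
def InQuadraticTime {α Γ : Type} (enc : α → List Γ) (f : α → Bool) : Prop :=
  ∃ M : TM2ComputableInTime enc encodeBool f,
    Asymptotics.IsBigO Filter.atTop (fun n : ℕ => (M.time n : ℝ)) fun n : ℕ => (n : ℝ) ^ 2

/-! A network is satisfiable if and only if one atom can be chosen from each label so that the
choice is symmetric, has `e` on the diagonal and contains only allowed triples
(`Network.satisfiable_iff`). The atoms that hold in a representation form such a choice. Conversely,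
every such colouring, once elements joined by `e` are identified, embeds into a representation on
pairs of a finite set of integers and an element. Two pairs are compared at the largest integer in
which their sets differ; nonnegative integers take precedence over the given colouring, negative
ones yield to it. Each diversity atom is the colour of arbitrarily large and of arbitrarily small
integers. Since an allowed triple of diversity atoms has two equal entries, this supplies every
witness that composition demands (`Lex.exists_between`).

The combinatorial core is Gallai's theorem on colourings without rainbow triangles
(`IsColoring.eq_e_of_connected`): on at least two distinct elements, some colour `c` is
disconnected. Between two components of `c` the colour is constant, and it is one of the other two
colours `s`, `t`. Dually, if the variables are partitioned so that between any two classes one of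
`s`, `t` lies in all labels, then the labels between classes can be discarded without affecting
solvability (`IsSplitting.colorable`). The finest such partition arises by merging classes between
which neither `s` nor `t` is possible. If for none of the three pairs of colours the finest
partition discards a nontrivial label, then in any solution every colour is connected on each
component of the graph of nontrivial labels. By Gallai's theorem the solution is constantly `e`
there, so solvability just means that every label contains `e` (`colorable_iff_of_relax_eq`).

For the running time with `m` variables: discarding a nontrivial label increases the number of
components of nontrivial labels (`IsSplitting.numClasses_linked_lt`), so there are `O(m)` rounds. A
finest partition takes `O(m)` merging rounds, because each one merges classes or finishes a pivot
(`mergeLoop_computes`). A merging round is a fixed number of sweeps through the matrix, of `O(m ^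
2)` steps each. The total `O(m ^ 4)` is `O(n ^ 2)` since `n = m ^ 2 + m`. The procedure is written
as a while program over stacks with explicit step counts and compiled to a machine. -/

set_option linter.constructorNameAsVariable false

/-! ### Satisfiability as the existence of a consistent choice of atoms -/

/-- A consistent atomic labelling of the pairs of elements of `V`. -/
structure IsColoring {V : Type*} (g : V → V → Atom) : Prop where
  refl : ∀ x, g x x = Atom.e
  symm : ∀ x y, g x y = g y x
  allowed : ∀ x y z, Atom.Allowed (g x y) (g y z) (g x z)

namespace AlgebraRepresentation

variable {B : Type u} (R : AlgebraRepresentation (Finset Atom) B)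

include R in
theorem rel_mono {X Y : Finset Atom} (h : X ⊆ Y) : R.rel X ⊆ R.rel Y := by
  have := R.rel_sup X Y
  rw [sup_eq_right.2 h] at this
  exact Set.union_eq_right.1 this

theorem exists_atom {p : B × B} {X : Finset Atom} (h : p ∈ R.rel X) :
    ∃ t ∈ X, p ∈ R.rel {t} := by
  induction X using Finset.induction with
  | empty =>
    have h' : p ∈ R.rel ⊥ := h
    rw [R.rel_bot] at h'
    exact h'.elim
  | insert t X _ ih =>
    have h' : p ∈ R.rel ({t} ⊔ X) := h
    rw [← R.rel_sup] at h'
    rcases h' with h' | h'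
    · exact ⟨t, Finset.mem_insert_self _ _, h'⟩
    · obtain ⟨w, hw, hp⟩ := ih h'
      exact ⟨w, Finset.mem_insert_of_mem hw, hp⟩

theorem atom_unique {p : B × B} {t w : Atom} (ht : p ∈ R.rel {t}) (hw : p ∈ R.rel {w}) :
    t = w := by
  by_contra hne
  have h : p ∈ R.rel ({t}ᶜ) := R.rel_mono (by simpa using fun h => hne h) hw
  rw [R.rel_compl] at h
  exact h.2 ht

theorem swap_mem {X : Finset Atom} {x y : B} (h : (x, y) ∈ R.rel X) : (y, x) ∈ R.rel X := by
  have := R.rel_conv X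
  change R.rel X = _ at this
  rw [this]
  exact h

end AlgebraRepresentation

/-- Every pair in the unit of a representation lies in the relation of exactly one atom, so an
assignment of the variables determines the colouring; the axioms for identity, converse and
composition make it consistent. -/
theorem Network.exists_coloring_of_satisfiable {N : Network (Finset Atom)}
    (h : Network.Satisfiable.{u} N) :
    ∃ g, IsColoring g ∧ ∀ x y, g x y ∈ N.label x y := by
  obtain ⟨B, R, s, h⟩ := h
  choose g hg hR using fun x y => R.exists_atom (h x y)
  refine ⟨g, ⟨fun x => ?_, fun x y => R.atom_unique (hR x y) (R.swap_mem (hR y x)),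
    fun x y z => ?_⟩, hg⟩
  · refine R.atom_unique (hR x x) ?_
    have := R.rel_ident
    change R.rel {Atom.e} = _ at this
    rw [this]
    rfl
  · have h1 : (s x, s z) ∈ R.rel (RelationAlgebra.comp {g x y} {g y z}) := by
      rw [← R.rel_comp]
      exact ⟨s y, hR x y, hR y z⟩
    obtain ⟨t, ht, hp⟩ := R.exists_atom h1
    obtain rfl := R.atom_unique hp (hR x z)
    simpa [RelationAlgebra.comp] using ht

/-! ### Representations that extend a given colouring -/

namespace Atom

/-- A colouring of the integers by diversity atoms, each of which occurs cofinally in both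
directions. -/
def level (n : ℤ) : Atom :=
  if n % 3 = 0 then a else if n % 3 = 1 then b else c

theorem level_ne (n : ℤ) : level n ≠ e := by
  unfold level; split_ifs <;> decide

/-- The witnesses are the first multiple of 3 above `N`, shifted by the residue that encodes the
atom. -/
theorem exists_level_gt {t : Atom} (ht : t ≠ e) (N : ℤ) : ∃ n > N, level n = t := by
  have h1 := Int.mul_ediv_add_emod N 3
  have h2 := Int.emod_nonneg N (b := 3) (by norm_num)
  cases t
  · exact absurd rfl ht
  · exact ⟨3 * (N / 3) + 3, by omega, by simp [level, show (3 * (N / 3) + 3) % 3 = 0 by omega]⟩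
  · exact ⟨3 * (N / 3) + 4, by omega, by simp [level, show (3 * (N / 3) + 4) % 3 = 1 by omega]⟩
  · exact ⟨3 * (N / 3) + 5, by omega, by simp [level, show (3 * (N / 3) + 5) % 3 = 2 by omega]⟩

theorem exists_level_lt {t : Atom} (ht : t ≠ e) (N : ℤ) : ∃ n < N, level n = t := by
  have h1 := Int.mul_ediv_add_emod N 3
  have h2 := Int.emod_lt_of_pos N (b := 3) (by norm_num)
  cases t
  · exact absurd rfl ht
  · exact ⟨3 * (N / 3) - 3, by omega, by simp [level, show (3 * (N / 3) - 3) % 3 = 0 by omega]⟩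
  · exact ⟨3 * (N / 3) - 2, by omega, by simp [level, show (3 * (N / 3) - 2) % 3 = 1 by omega]⟩
  · exact ⟨3 * (N / 3) - 1, by omega, by simp [level, show (3 * (N / 3) - 1) % 3 = 2 by omega]⟩

/-- The atom of a level, where the absent level has the identity atom. -/
def levelBot : WithBot ℤ → Atom
  | ⊥ => e
  | (n : ℤ) => level n

theorem levelBot_coe (n : ℤ) : levelBot n = level n := rfl

theorem levelBot_eq_e {t : WithBot ℤ} : levelBot t = e ↔ t = ⊥ := by
  cases t with
  | bot => simp [levelBot]
  | coe n => simp [levelBot, level_ne]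

/-- An isosceles triple whose equal legs are not the identity tolerates any third side. All
consistency proofs below reduce to finding two equal sides. -/
theorem allowed_of_eq : ∀ x y : Atom, x ≠ e → Allowed x x y ∧ Allowed x y x ∧ Allowed y x x := by
  decide

end Atom

/-! ### The lexicographic extension of a colouring -/

namespace Lex

open Atom

/-- The most significant position at which two finite sets of integers differ. -/
def top (s t : Finset ℤ) : WithBot ℤ := (symmDiff s t).max

theorem top_comm (s t : Finset ℤ) : top s t = top t s := by
  rw [top, symmDiff_comm, top]

theorem top_eq_bot {s t : Finset ℤ} : top s t = ⊥ ↔ s = t := by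
  rw [top, Finset.max_eq_bot]
  exact symmDiff_eq_bot

/-- This ultrametric inequality forces the largest of the three values of a triangle to occur twice.
-/
theorem top_triangle (s t r : Finset ℤ) : top s r ≤ max (top s t) (top t r) := by
  unfold top
  have h := Finset.max_mono (symmDiff_triangle s t r)
  rwa [Finset.sup_eq_union, Finset.max_union] at h

theorem top_toggle_self (s : Finset ℤ) (n : ℤ) : top s (symmDiff s {n}) = n := by
  rw [top, symmDiff_symmDiff_cancel_left, Finset.max_singleton]

theorem top_toggle_high {s t : Finset ℤ} {n : ℤ} (h : ∀ k ∈ symmDiff s t, k < n) :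
    top (symmDiff s {n}) t = n := by
  rw [top, symmDiff_right_comm]
  refine le_antisymm (Finset.max_le fun k hk => ?_) (Finset.le_max ?_)
  · rw [Finset.mem_symmDiff, Finset.mem_singleton] at hk
    rcases hk with hk | hk
    · exact WithBot.coe_le_coe.2 (h k hk.1).le
    · exact WithBot.coe_le_coe.2 hk.1.le
  · rw [Finset.mem_symmDiff, Finset.mem_singleton]
    exact Or.inr ⟨rfl, fun hn => lt_irrefl _ (h n hn)⟩

theorem top_toggle_low {s t : Finset ℤ} {n : ℤ} (hne : s ≠ t) (h : ∀ k ∈ symmDiff s t, n < k) :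
    top (symmDiff s {n}) t = top s t := by
  rw [top, symmDiff_right_comm, top]
  have hn : n ∉ symmDiff s t := fun hn => lt_irrefl _ (h n hn)
  have h1 : symmDiff (symmDiff s t) {n} = symmDiff s t ∪ {n} := by
    ext k
    simp only [Finset.mem_symmDiff (s := symmDiff s t), Finset.mem_union, Finset.mem_singleton]
    constructor
    · tauto
    · rintro (hk | rfl)
      · exact Or.inl ⟨hk, (h k hk).ne'⟩
      · exact Or.inr ⟨rfl, hn⟩
  have hne' : (symmDiff s t).Nonempty :=
    Finset.nonempty_iff_ne_empty.2 fun h0 => hne (symmDiff_eq_bot.1 h0)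
  obtain ⟨k, hk⟩ := hne'
  rw [h1, Finset.max_union, Finset.max_singleton, max_eq_left]
  exact (WithBot.coe_le_coe.2 (h k hk).le).trans (Finset.le_max hk)

variable {V : Type*} (g : V → V → Atom)

open Classical in
/-- The lexicographic colouring: positive levels are more significant than `g`, and negative ones
are less significant. -/
noncomputable def col (p q : Finset ℤ × V) : Atom :=
  if p.2 = q.2 ∨ 0 ≤ top p.1 q.1 then levelBot (top p.1 q.1) else g p.2 q.2

variable {g}

theorem levelBot_ne {t : WithBot ℤ} (h : 0 ≤ t) : levelBot t ≠ e := by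
  rw [Ne, levelBot_eq_e]
  rintro rfl
  simp at h

theorem col_eq_e (hg : ∀ x y, g x y = e → x = y) {p q : Finset ℤ × V} :
    col g p q = e ↔ p = q := by
  unfold col
  split_ifs with h
  · rw [levelBot_eq_e, Prod.ext_iff]
    constructor
    · intro h1
      refine ⟨top_eq_bot.1 h1, h.resolve_right ?_⟩
      simp [h1]
    · intro h1
      exact top_eq_bot.2 h1.1
  · constructor
    · intro h1
      exact absurd (Or.inl (hg _ _ h1)) h
    · rintro rfl
      exact absurd (Or.inl rfl) h

/-- If the largest of the three levels is at least 0, it occurs twice by the ultrametric inequality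
and gives two equal diversity atoms. Otherwise `g` decides wherever the second components differ: if
exactly two of them coincide, two sides carry the same value of `g`; if all coincide, the
ultrametric argument applies again; if all differ, the triple is one of `g`. -/
theorem col_isColoring (hc : IsColoring g) (hg : ∀ x y, g x y = e → x = y) :
    IsColoring (col g) where
  refl _ := (col_eq_e hg).2 rfl
  symm p q := by
    unfold col
    rw [top_comm, hc.symm, eq_comm (a := p.2)]
  allowed := by
    rintro ⟨s, x⟩ ⟨t, y⟩ ⟨r, z⟩
    have h1 := top_triangle s t r
    have h2 := top_triangle s r t
    have h3 := top_triangle t s r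
    rw [top_comm r t] at h2
    rw [top_comm t s] at h3
    unfold col
    generalize top s t = A at *
    generalize top t r = B at *
    generalize top s r = C at *
    have hgne : ∀ {x y}, x ≠ y → g x y ≠ e := fun h h' => h (hg _ _ h')
    rcases lt_or_ge (max A (max B C)) 0 with hneg | hpos
    · have hA : ¬ 0 ≤ A := not_le.2 (lt_of_le_of_lt (le_max_left _ _) hneg)
      have hB : ¬ 0 ≤ B :=
        not_le.2 (lt_of_le_of_lt ((le_max_left _ _).trans (le_max_right _ _)) hneg)
      have hC : ¬ 0 ≤ C :=
        not_le.2 (lt_of_le_of_lt ((le_max_right _ _).trans (le_max_right _ _)) hneg)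
      by_cases hxy : x = y
      · subst hxy
        by_cases hxz : x = z
        · subst hxz
          simp only [true_or, if_true]
          have key : (A = B ∧ C ≤ A) ∨ (A = C ∧ B ≤ A) ∨ (B = C ∧ A ≤ B) := by grind
          have hbot : ∀ {X Y : WithBot ℤ}, X ≤ Y → levelBot Y = e → levelBot X = e := by
            intro X Y h h'
            rw [levelBot_eq_e] at h' ⊢
            subst h'
            exact le_bot_iff.1 h
          rcases key with ⟨rfl, h⟩ | ⟨rfl, h⟩ | ⟨rfl, h⟩
          · by_cases he : levelBot A = e
            · rw [he, hbot h he]; decide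
            · exact (allowed_of_eq _ _ he).1
          · by_cases he : levelBot A = e
            · rw [he, hbot h he]; decide
            · exact (allowed_of_eq _ _ he).2.1
          · by_cases he : levelBot B = e
            · rw [he, hbot h he]; decide
            · exact (allowed_of_eq _ _ he).2.2
        · simp only [true_or, false_or, hA, hB, hC, if_true, hxz, if_false]
          exact (allowed_of_eq _ _ (hgne hxz)).2.2
      · by_cases hyz : y = z
        · subst hyz
          simp only [true_or, false_or, hA, hB, hC, hxy, if_true, if_false]
          exact (allowed_of_eq _ _ (hgne hxy)).2.1
        · by_cases hxz : x = z
          · subst hxz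
            simp only [true_or, false_or, hA, hB, hC, hxy, hyz, if_true, if_false]
            rw [hc.symm y x]
            exact (allowed_of_eq _ _ (hgne hxy)).1
          · simp only [false_or, hA, hB, hC, hxy, hyz, hxz, if_false]
            exact hc.allowed x y z
    · have key : (0 ≤ A ∧ A = B) ∨ (0 ≤ A ∧ A = C) ∨ (0 ≤ B ∧ B = C) := by grind
      rcases key with ⟨h, rfl⟩ | ⟨h, rfl⟩ | ⟨h, rfl⟩
      · simp only [h, or_true, if_true]
        exact (allowed_of_eq _ _ (levelBot_ne h)).1
      · simp only [h, or_true, if_true]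
        exact (allowed_of_eq _ _ (levelBot_ne h)).2.1
      · simp only [h, or_true, if_true]
        exact (allowed_of_eq _ _ (levelBot_ne h)).2.2

/-- Toggling a very low level in `p` yields a point that is near `p` in the prescribed colour and
that `q` cannot tell from `p`. -/
theorem exists_twin (p q : Finset ℤ × V) (hpq : p ≠ q) {t : Atom} (ht : t ≠ e) :
    ∃ w, col g p w = t ∧ col g w q = col g p q := by
  obtain ⟨N, hN⟩ := (symmDiff p.1 q.1).bddBelow
  -- The bound 0 matters when the first components agree: a negative level then leaves the colour
  -- towards `q` to `g`.
  obtain ⟨n, hn, rfl⟩ := exists_level_lt ht (min N 0)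
  have hlow : ∀ k ∈ symmDiff p.1 q.1, n < k := fun k hk => by
    have := hN (Finset.mem_coe.2 hk)
    omega
  refine ⟨(symmDiff p.1 {n}, p.2), ?_, ?_⟩
  · simp only [col, top_toggle_self, true_or, if_true, levelBot_coe]
  · by_cases h : p.1 = q.1
    · have h2 : p.2 ≠ q.2 := fun h2 => hpq (Prod.ext h h2)
      have h0 : ¬ (0 : WithBot ℤ) ≤ n := by
        rw [← WithBot.coe_zero, WithBot.coe_le_coe]; omega
      have hb : top p.1 q.1 = ⊥ := top_eq_bot.2 h
      have hn' : top (symmDiff p.1 {n}) q.1 = n := by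
        rw [← h, top_comm, top_toggle_self]
      simp [col, hb, hn', h2, h0]
    · unfold col
      rw [top_toggle_low h hlow]

/-- Toggling a level above 0 and above all differences between `p` and `q` yields a point that sees
both of them at this level. -/
theorem exists_far (p q : Finset ℤ × V) {t : Atom} (ht : t ≠ e) :
    ∃ w, col g p w = t ∧ col g w q = t := by
  obtain ⟨N, hN⟩ := (symmDiff p.1 q.1).bddAbove
  obtain ⟨n, hn, rfl⟩ := exists_level_gt ht (max N 0)
  have hhigh : ∀ k ∈ symmDiff p.1 q.1, k < n := fun k hk => by
    have := hN (Finset.mem_coe.2 hk)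
    omega
  have h0 : (0 : WithBot ℤ) ≤ n := by
    rw [← WithBot.coe_zero, WithBot.coe_le_coe]; omega
  refine ⟨(symmDiff p.1 {n}, p.2), ?_, ?_⟩
  · simp only [col, top_toggle_self, true_or, if_true, levelBot_coe]
  · simp only [col, top_toggle_high hhigh, h0, or_true, if_true, levelBot_coe]

/-- An allowed triple contains `e` or has two equal diversity atoms. If the two new sides agree, a
far point works; if a new side equals the old one, a twin of `p` or of `q` does. -/
theorem exists_between (hc : IsColoring g) (hg : ∀ x y, g x y = e → x = y)
    (p q : Finset ℤ × V) {t w : Atom} (h : Allowed t w (col g p q)) :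
    ∃ z, col g p z = t ∧ col g z q = w := by
  have hcol := col_isColoring hc hg
  rcases h with ⟨rfl, h⟩ | ⟨rfl, h⟩ | ⟨h, rfl⟩ | ⟨ht, hw, hz, h⟩
  · exact ⟨p, hcol.refl p, h.symm⟩
  · exact ⟨q, h.symm, hcol.refl q⟩
  · obtain rfl := (col_eq_e hg).1 h
    by_cases ht : t = e
    · subst ht
      exact ⟨p, h, h⟩
    · exact exists_far p p ht
  · have hpq : p ≠ q := fun h' => hz ((col_eq_e hg).2 h')
    rcases h with rfl | rfl | rfl
    · exact exists_far p q ht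
    · exact exists_twin p q hpq ht
    · obtain ⟨z, h1, h2⟩ := exists_twin (g := g) q p hpq.symm hw
      exact ⟨z, by rw [hcol.symm, h2, hcol.symm], by rw [hcol.symm, h1]⟩

/-- The representation on the lexicographic extension of a colouring. -/
noncomputable def representation (hc : IsColoring g) (hg : ∀ x y, g x y = e → x = y) :
    AlgebraRepresentation (Finset Atom) (ULift.{u} (Finset ℤ × V)) where
  rel X := {p | col g p.1.down p.2.down ∈ X}
  rel_bot := by ext p; simp
  rel_top := by
    ext p
    simp only [Set.mem_ofPred_eq, Set.mem_iUnion]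
    exact ⟨fun h => ⟨_, h⟩, fun _ => Finset.mem_univ _⟩
  rel_ident := by
    ext p
    change _ ∈ ({e} : Finset Atom) ↔ _
    rw [Finset.mem_singleton, col_eq_e hg]
    exact ⟨fun h => ULift.ext _ _ h, fun h => congrArg ULift.down h⟩
  rel_compl X := by ext p; simp
  rel_conv X := by
    ext p
    change _ ∈ X ↔ _ ∈ X
    rw [(col_isColoring hc hg).symm]
  rel_sup X Y := by ext p; simp
  rel_comp X Y := by
    ext p
    simp only [Set.mem_ofPred_eq, RelationAlgebra.comp, Finset.mem_filter, Finset.mem_univ,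
      true_and]
    constructor
    · rintro ⟨w, hx, hy⟩
      exact ⟨_, hx, _, hy, (col_isColoring hc hg).allowed _ _ _⟩
    · rintro ⟨x, hx, y, hy, h⟩
      obtain ⟨w, rfl, rfl⟩ := exists_between hc hg _ _ h
      exact ⟨⟨w⟩, hx, hy⟩

end Lex

/-! ### Identifying elements that are joined by the identity atom -/

namespace IsColoring

variable {V : Type*} {g : V → V → Atom} (hg : IsColoring g)

include hg

theorem eq_of_left {x y z : V} (h : g x y = Atom.e) : g x z = g y z := by
  have := hg.allowed x y z
  revert this
  rw [h]
  generalize g y z = s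
  generalize g x z = t
  revert s t
  decide

theorem eq_of_right {x y z : V} (h : g x y = Atom.e) : g z x = g z y := by
  rw [hg.symm z x, hg.symm z y, hg.eq_of_left h]

/-- Equality of elements, as seen by a colouring. -/
def setoid : Setoid V where
  r x y := g x y = Atom.e
  iseqv := ⟨hg.refl, fun h => (hg.symm _ _).trans h, fun h h' => (hg.eq_of_left h).trans h'⟩

end IsColoring

/-- The lexicographic construction needs distinct elements to have a diversity atom, hence the
passage to the quotient. The variables are placed at the empty set, where no level differs and the
colours are those of `g`. -/
theorem Network.satisfiable_iff {N : Network (Finset Atom)} :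
    Network.Satisfiable.{u} N ↔ ∃ g, IsColoring g ∧ ∀ x y, g x y ∈ N.label x y := by
  refine ⟨Network.exists_coloring_of_satisfiable, ?_⟩
  rintro ⟨g, hg, hN⟩
  let g' : Quotient hg.setoid → Quotient hg.setoid → Atom :=
    fun x y => Quotient.liftOn₂ (s₁ := hg.setoid) (s₂ := hg.setoid) x y g
      fun _ _ _ _ h h' => (hg.eq_of_left h).trans (hg.eq_of_right h')
  have hc : IsColoring g' := by
    refine ⟨?_, ?_, ?_⟩
    · rintro ⟨x⟩; exact hg.refl x
    · rintro ⟨x⟩ ⟨y⟩; exact hg.symm x y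
    · rintro ⟨x⟩ ⟨y⟩ ⟨z⟩; exact hg.allowed x y z
  have he : ∀ x y, g' x y = Atom.e → x = y := by
    rintro ⟨x⟩ ⟨y⟩ h; exact Quotient.sound h
  refine ⟨_, Lex.representation hc he, fun x => ⟨(∅, Quotient.mk _ x)⟩, fun x y => ?_⟩
  change Lex.col g' _ _ ∈ N.label x y
  have : Lex.col g' (∅, Quotient.mk hg.setoid x) (∅, Quotient.mk hg.setoid y) = g x y := by
    have hb : Lex.top ∅ ∅ = ⊥ := Lex.top_eq_bot.2 rfl
    unfold Lex.col
    simp only [hb]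
    split_ifs with h
    · have : g x y = Atom.e := Quotient.exact (h.resolve_right (by rw [hb]; simp))
      rw [this]; rfl
    · rfl
  rw [this]
  exact hN x y

/-! ### Rainbow-free colourings: disconnected colours -/

namespace IsColoring

variable {V : Type*} {g : V → V → Atom}

/-- Connectedness inside `W` by edges with colour `c` or the identity. -/
def Conn (g : V → V → Atom) (c : Atom) (W : Set V) : V → V → Prop :=
  Relation.EqvGen fun x y => x ∈ W ∧ y ∈ W ∧ (g x y = c ∨ g x y = Atom.e)

theorem Conn.equivalence (g : V → V → Atom) (c : Atom) (W : Set V) :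
    Equivalence (Conn g c W) :=
  Relation.EqvGen.is_equivalence _

theorem Conn.of_eq {c : Atom} {W : Set V} {x y : V} (hx : x ∈ W) (hy : y ∈ W)
    (h : g x y = c ∨ g x y = Atom.e) : Conn g c W x y :=
  Relation.EqvGen.rel _ _ ⟨hx, hy, h⟩

theorem _root_.Atom.eq_of_allowed : ∀ c s t r : Atom, (s = c ∨ s = Atom.e) → ¬(t = c ∨ t = Atom.e) →
    ¬(r = c ∨ r = Atom.e) → Atom.Allowed s t r → t = r := by
  decide

/-- Between different components of a colour, the atom is constant. -/
theorem Conn.eq_left (hg : IsColoring g) {c : Atom} {W : Set V} {x x' y : V}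
    (h : Conn g c W x x') (hy : y ∈ W) (hxy : ¬ Conn g c W x y) : g x y = g x' y := by
  induction h with
  | rel x x' h =>
    have hxx' : Conn g c W x x' := Relation.EqvGen.rel _ _ h
    refine Atom.eq_of_allowed c (g x' x) _ _ (by rw [hg.symm]; exact h.2.2)
      (fun h' => hxy (Conn.of_eq h.1 hy h')) (fun h' => hxy ?_) (hg.allowed x' x y)
    exact (Conn.equivalence g c W).trans hxx' (Conn.of_eq h.2.1 hy h')
  | refl => rfl
  | symm x x' h ih =>
    exact (ih fun h' => hxy ((Conn.equivalence g c W).trans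
      ((Conn.equivalence g c W).symm h) h')).symm
  | trans x x' x'' h h' ih ih' =>
    exact (ih hxy).trans (ih' fun h1 => hxy ((Conn.equivalence g c W).trans h h1))

theorem Conn.eq (hg : IsColoring g) {c : Atom} {W : Set V} {x x' y y' : V} (hx : x' ∈ W)
    (hy : y ∈ W) (h : Conn g c W x x') (h' : Conn g c W y y') (hxy : ¬ Conn g c W x y) :
    g x y = g x' y' := by
  rw [h.eq_left hg hy hxy, hg.symm x' y, hg.symm x' y']
  refine h'.eq_left hg hx fun h1 => hxy ?_
  exact (Conn.equivalence g c W).trans h ((Conn.equivalence g c W).symm h1)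

theorem _root_.Atom.exists_others : ∀ c : Atom, c ≠ Atom.e → ∃ s t : Atom, s ≠ Atom.e ∧ t ≠ Atom.e ∧ s ≠ t ∧
    s ≠ c ∧ t ≠ c ∧ ∀ r : Atom, r = Atom.e ∨ r = c ∨ r = s ∨ r = t := by
  decide

theorem _root_.Atom.exists_other : ∀ c : Atom, ∃ s : Atom, s ≠ Atom.e ∧ s ≠ c := by
  decide

/-- If a set of edges that is closed under steps contains an element, it contains its component. -/
theorem Conn.mem_of_closed {c : Atom} {W : Set V} {S : V → Prop} {x y : V}
    (hS : ∀ x y, x ∈ W → y ∈ W → (g x y = c ∨ g x y = Atom.e) → (S x ↔ S y))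
    (h : Conn g c W x y) : S x ↔ S y := by
  induction h with
  | rel x y h => exact hS x y h.1 h.2.1 h.2.2
  | refl => rfl
  | symm _ _ _ ih => exact ih.symm
  | trans _ _ _ _ _ ih ih' => exact ih.trans ih'

/-- In a rainbow-free colouring of a finite set with at least two elements, not all of the colours
are connected. -/
theorem eq_e_of_connected (hg : IsColoring g) (W : Finset V)
    (hW : ∀ c ≠ Atom.e, ∀ x ∈ W, ∀ y ∈ W, Conn g c W x y) : ∀ x ∈ W, ∀ y ∈ W, g x y = Atom.e := by
  classical
  induction W using Finset.induction with
  | empty => simp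
  | insert v W hv ih =>
    -- If `W` is a single element up to identity, all edges from `v` to `W` have the same atom. Were
    -- it a diversity atom, another colour would leave `v` isolated.
    by_cases hconst : ∀ x ∈ W, ∀ y ∈ W, g x y = Atom.e
    · suffices hvW : ∀ w ∈ W, g v w = Atom.e by
        intro x hx y hy
        rw [Finset.mem_insert] at hx hy
        rcases hx with rfl | hx <;> rcases hy with rfl | hy
        · exact hg.refl _
        · exact hvW _ hy
        · rw [hg.symm]; exact hvW _ hx
        · exact hconst _ hx _ hy
      intro w hw
      by_contra hne
      obtain ⟨c, hc, hcd⟩ := Atom.exists_other (g v w)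
      have hconn := hW c hc v (Finset.mem_insert_self _ _) w (Finset.mem_insert_of_mem hw)
      have := Conn.mem_of_closed (S := fun x => x = v) (fun x y hx hy h => ?_) hconn
      · have hwv := this.1 rfl
        subst hwv
        exact hv hw
      · have key : ∀ y ∈ W, ¬ (g v y = c ∨ g v y = Atom.e) := by
          intro y hy
          rw [← hg.eq_of_right (hconst w hw y hy)]
          rintro (h | h)
          · exact hcd h.symm
          · exact hne h
        rw [Finset.mem_coe, Finset.mem_insert] at hx hy
        rcases hx with rfl | hx <;> rcases hy with rfl | hy
        · rfl
        · exact absurd h (key y hy)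
        · rw [hg.symm] at h; exact absurd h (key x hx)
        · constructor
          · rintro rfl; exact absurd hx hv
          · rintro rfl; exact absurd hy hv
    · exfalso
      -- By the induction hypothesis some colour is disconnected on `W`. It is connected after `v`
      -- is added, so all of its components are joined through `v`.
      have hex : ∃ c, c ≠ Atom.e ∧ ∃ x ∈ W, ∃ y ∈ W, ¬ Conn g c W x y := by
        by_contra! h
        exact hconst (ih h)
      obtain ⟨c, hc, x₀, hx₀, y₀, hy₀, hxy₀⟩ := hex
      have hE := Conn.equivalence g c (W : Set V)
      -- every component has an edge to the new element
      have hto : ∀ w ∈ W, ∃ w' ∈ W, Conn g c W w w' ∧ (g v w' = c ∨ g v w' = Atom.e) := by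
        intro w hw
        by_contra! hno
        have hS : ∀ z ∈ W, Conn g c W w z := by
          intro z hz
          have hconn := hW c hc w (Finset.mem_insert_of_mem hw) z (Finset.mem_insert_of_mem hz)
          refine ((Conn.mem_of_closed (S := fun x => x ∈ W ∧ Conn g c W w x)
            (fun x y hx hy h => ?_) hconn).1 ⟨hw, hE.refl w⟩).2
          rw [Finset.mem_coe, Finset.mem_insert] at hx hy
          rcases hx with rfl | hx <;> rcases hy with rfl | hy
          · rfl
          · constructor
            · exact fun h' => absurd h'.1 hv
            · rintro ⟨h1, h2⟩
              have := hno y h1 h2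
              tauto
          · rw [hg.symm] at h
            constructor
            · rintro ⟨h1, h2⟩
              have := hno x h1 h2
              tauto
            · exact fun h' => absurd h'.1 hv
          · have hxy : Conn g c W x y := Conn.of_eq hx hy h
            exact ⟨fun h' => ⟨hy, hE.trans h'.2 hxy⟩,
              fun h' => ⟨hx, hE.trans h'.2 (hE.symm hxy)⟩⟩
        exact hxy₀ (hE.trans (hE.symm (hS x₀ hx₀)) (hS y₀ hy₀))
      have hfar : ∀ w, ∃ z ∈ W, ¬ Conn g c W w z := by
        intro w
        by_contra! h
        exact hxy₀ (hE.trans (hE.symm (h x₀ hx₀)) (h y₀ hy₀))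
      have hnotin : ∀ {x y}, x ∈ W → y ∈ W → ¬ Conn g c W x y → ¬ (g x y = c ∨ g x y = Atom.e) :=
        fun hx hy h h' => h (Conn.of_eq hx hy h')
      -- another colour of an edge to the new element determines the colour to the outside
      have hdet : ∀ d, d ≠ c → d ≠ Atom.e → ∃ y ∈ W, ∀ z ∈ W, ¬ Conn g c W y z → g y z = d := by
        intro d hdc hde
        -- Since `d` is connected on the enlarged set as well, `v` cannot be isolated in it.
        have hy : ∃ y ∈ W, g v y = d ∨ g v y = Atom.e := by
          by_contra! hno
          have hconn := hW d hde v (Finset.mem_insert_self _ _) x₀ (Finset.mem_insert_of_mem hx₀)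
          have := Conn.mem_of_closed (S := fun x => x = v) (fun x y hx hy h => ?_) hconn
          · have hwv := this.1 rfl
            subst hwv
            exact hv hx₀
          · rw [Finset.mem_coe, Finset.mem_insert] at hx hy
            rcases hx with rfl | hx <;> rcases hy with rfl | hy
            · rfl
            · have := hno y hy; tauto
            · rw [hg.symm] at h; have := hno x hx; tauto
            · constructor
              · rintro rfl; exact absurd hx hv
              · rintro rfl; exact absurd hy hv
        obtain ⟨y, hy, hvy⟩ := hy
        have hval : ∀ z ∈ W, ¬ Conn g c W y z → g y z = g v y := by
          intro z hz hyz
          obtain ⟨z', hz', hzz', hvz'⟩ := hto z hz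
          have hyz' : ¬ Conn g c W y z' := fun h => hyz (hE.trans h (hE.symm hzz'))
          rw [Conn.eq hg hy hz (hE.refl y) hzz' hyz]
          -- In the triangle `v`, `y`, `z'`, the side `v z'` is `c` or `e`, and `y z'` is neither.
          -- Without rainbows this leaves only that `y z'` has the atom of `v y`.
          have h1 := hnotin hy hz' hyz'
          have h2 := hg.allowed v y z'
          revert h1 h2 hvz' hvy hdc hde
          generalize g v y = p
          generalize g y z' = q
          generalize g v z' = r
          clear * -
          revert c d p q r
          decide
        refine ⟨y, hy, fun z hz hyz => ?_⟩
        rw [hval z hz hyz]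
        rcases hvy with h | h
        · exact h
        · exact absurd (Or.inr ((hval z hz hyz).trans h)) (hnotin hy hz hyz)
      -- For each of the two remaining colours, some component has all its outgoing edges in that
      -- colour. Whether these two components coincide or not, some edge would have both colours.
      obtain ⟨s, t, hs, ht, hst, hsc, htc, -⟩ := Atom.exists_others c hc
      obtain ⟨y, hy, hys⟩ := hdet s hsc hs
      obtain ⟨y', hy', hyt⟩ := hdet t htc ht
      by_cases hyy' : Conn g c W y y'
      · obtain ⟨z, hz, hyz⟩ := hfar y
        have hyz' : ¬ Conn g c W y' z := fun h => hyz (hE.trans hyy' h)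
        have h1 := Conn.eq_left hg hyy' hz hyz
        rw [hys z hz hyz, hyt z hz hyz'] at h1
        exact hst h1
      · have h1 := hyt y hy fun h => hyy' (hE.symm h)
        rw [hg.symm, hys y' hy' hyy'] at h1
        exact hst h1

end IsColoring

/-! ### Splitting a network -/

section Splitting

variable {V : Type*}

/-- There is a consistent choice of atoms from the labels. -/
def Colorable (f : V → V → Finset Atom) : Prop :=
  ∃ g, IsColoring g ∧ ∀ x y, g x y ∈ f x y

/-- Some pair between the classes of `x` and `y` lacks the atom `d` in one of its two labels. -/
def Lacks (f : V → V → Finset Atom) (P : V → V → Prop) (d : Atom) (x y : V) : Prop :=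
  ∃ i k, P x i ∧ P y k ∧ (d ∉ f i k ∨ d ∉ f k i)

/-- Neither of two atoms can be chosen throughout between the classes of `x` and `y`. -/
def Blocked (f : V → V → Finset Atom) (s t : Atom) (P : V → V → Prop) (x y : V) : Prop :=
  Lacks f P s x y ∧ Lacks f P t x y

/-- An equivalence relation such that for any two classes, one of the two atoms can be chosen
throughout between them. -/
structure IsSplitting (f : V → V → Finset Atom) (s t : Atom) (P : V → V → Prop) : Prop where
  equivalence : Equivalence P
  of_blocked : ∀ x y, Blocked f s t P x y → P x y

/-- The finest splitting. -/
structure IsFinestSplitting (f : V → V → Finset Atom) (s t : Atom) (P : V → V → Prop) : Prop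
    extends IsSplitting f s t P where
  le : ∀ Q, IsSplitting f s t Q → ∀ x y, P x y → Q x y

open Classical in
/-- Forget the labels between different classes. -/
noncomputable def relax (f : V → V → Finset Atom) (P : V → V → Prop) (x y : V) : Finset Atom :=
  if P x y then f x y else Finset.univ

variable {f : V → V → Finset Atom} {s t : Atom} {P Q : V → V → Prop}

theorem Lacks.symm {d : Atom} {x y : V} (h : Lacks f P d x y) : Lacks f P d y x := by
  obtain ⟨i, k, hi, hk, h⟩ := h
  exact ⟨k, i, hk, hi, h.symm⟩

theorem Lacks.mono {d : Atom} {x y x' y' : V} (hx : ∀ i, P x i → Q x' i)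
    (hy : ∀ i, P y i → Q y' i) (h : Lacks f P d x y) : Lacks f Q d x' y' := by
  obtain ⟨i, k, hi, hk, h⟩ := h
  exact ⟨i, k, hx i hi, hy k hk, h⟩

theorem Blocked.symm {x y : V} (h : Blocked f s t P x y) : Blocked f s t P y x :=
  ⟨h.1.symm, h.2.symm⟩

theorem Blocked.mono {x y x' y' : V} (hx : ∀ i, P x i → Q x' i)
    (hy : ∀ i, P y i → Q y' i) (h : Blocked f s t P x y) : Blocked f s t Q x' y' :=
  ⟨h.1.mono hx hy, h.2.mono hx hy⟩

theorem Blocked.congr (hP : Equivalence P) {x y x' y' : V} (hx : P x x') (hy : P y y')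
    (h : Blocked f s t P x y) : Blocked f s t P x' y' :=
  h.mono (fun _ hi => hP.trans (hP.symm hx) hi) (fun _ hi => hP.trans (hP.symm hy) hi)

theorem Colorable.relax (h : Colorable f) : Colorable (relax f P) := by
  obtain ⟨g, hg, hf⟩ := h
  refine ⟨g, hg, fun x y => ?_⟩
  unfold _root_.relax
  split_ifs
  · exact hf x y
  · exact Finset.mem_univ _

theorem Lacks.congr_iff (hP : Equivalence P) {d : Atom} {x y x' y' : V} (hx : P x x')
    (hy : P y y') : Lacks f P d x y ↔ Lacks f P d x' y' :=
  ⟨fun h => h.mono (fun _ hi => hP.trans (hP.symm hx) hi) (fun _ hi => hP.trans (hP.symm hy) hi),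
    fun h => h.mono (fun _ hi => hP.trans hx hi) (fun _ hi => hP.trans hy hi)⟩

theorem _root_.Atom.allowed_of_two : ∀ s t p q r : Atom, s ≠ Atom.e → t ≠ Atom.e → (p = s ∨ p = t) →
    (q = s ∨ q = t) → (r = s ∨ r = t) → Atom.Allowed p q r := by
  decide

/-- Keep the given colouring inside the classes; between two classes use `s` if it is possible
throughout and `t` otherwise. A triple that meets two classes has two equal sides across, and a
triple that meets three classes uses only `s` and `t`, so no rainbow arises. -/
theorem IsSplitting.colorable (hP : IsSplitting f s t P) (hs : s ≠ Atom.e) (ht : t ≠ Atom.e)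
    (h : Colorable (relax f P)) : Colorable f := by
  classical
  obtain ⟨g, hg, hf⟩ := h
  have hE := hP.equivalence
  set h : V → V → Atom := fun x y => if Lacks f P s x y then t else s with hh
  have hcongr : ∀ {x y x' y'}, P x x' → P y y' → h x y = h x' y' := by
    intro x y x' y' hx hy
    simp only [hh, Lacks.congr_iff hE hx hy]
  have hsymm : ∀ x y, h x y = h y x := by
    intro x y
    simp only [hh, show Lacks f P s x y ↔ Lacks f P s y x from ⟨Lacks.symm, Lacks.symm⟩]
  have hst : ∀ x y, h x y = s ∨ h x y = t := by
    intro x y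
    simp only [hh]
    split_ifs <;> simp
  have hne : ∀ x y, h x y ≠ Atom.e := by
    intro x y
    rcases hst x y with h | h <;> rw [h] <;> assumption
  refine ⟨fun x y => if P x y then g x y else h x y, ⟨fun x => ?_, fun x y => ?_,
    fun x y z => ?_⟩, fun x y => ?_⟩
  · simp only [hE.refl x, if_true, hg.refl]
  · simp only [show P x y ↔ P y x from ⟨hE.symm, hE.symm⟩, hg.symm x y, hsymm x y]
  · by_cases hxy : P x y
    · by_cases hyz : P y z
      · simp only [hxy, hyz, hE.trans hxy hyz, if_true]
        exact hg.allowed x y z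
      · have hxz : ¬ P x z := fun h' => hyz (hE.trans (hE.symm hxy) h')
        simp only [hxy, hyz, hxz, if_true, if_false, hcongr hxy (hE.refl z)]
        exact (Atom.allowed_of_eq _ _ (hne y z)).2.2
    · by_cases hyz : P y z
      · have hxz : ¬ P x z := fun h' => hxy (hE.trans h' (hE.symm hyz))
        simp only [hxy, hyz, hxz, if_true, if_false, hcongr (hE.refl x) hyz]
        exact (Atom.allowed_of_eq _ _ (hne x z)).2.1
      · by_cases hxz : P x z
        · simp only [hxy, hyz, hxz, if_true, if_false]
          rw [hcongr hxz (hE.refl y), hsymm z y]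
          exact (Atom.allowed_of_eq _ _ (hne y z)).1
        · simp only [hxy, hyz, hxz, if_false]
          exact Atom.allowed_of_two s t _ _ _ hs ht (hst _ _) (hst _ _) (hst _ _)
  · simp only
    by_cases hxy : P x y
    · have := hf x y
      rw [relax, if_pos hxy] at this
      rwa [if_pos hxy]
    · rw [if_neg hxy]
      have hnb : ∀ d, ¬ Lacks f P d x y → d ∈ f x y := by
        intro d hd
        by_contra hmem
        exact hd ⟨x, y, hE.refl x, hE.refl y, Or.inl hmem⟩
      simp only [hh]
      split_ifs with hl
      · exact hnb t fun ht' => hxy (hP.of_blocked x y ⟨hl, ht'⟩)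
      · exact hnb s hl

/-- The equivalence relation generated by the pairs with a nontrivial label. -/
def Linked (f : V → V → Finset Atom) : V → V → Prop :=
  Relation.EqvGen fun x y => f x y ≠ Finset.univ

theorem Linked.equivalence (f : V → V → Finset Atom) : Equivalence (Linked f) :=
  Relation.EqvGen.is_equivalence _

theorem Linked.of_ne {x y : V} (h : f x y ≠ Finset.univ) : Linked f x y :=
  Relation.EqvGen.rel _ _ h

theorem Linked.le_of_forall (hP : Equivalence P) (h : ∀ x y, f x y ≠ Finset.univ → P x y)
    {x y : V} (hxy : Linked f x y) : P x y := by
  induction hxy with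
  | rel x y hxy => exact h x y hxy
  | refl x => exact hP.refl x
  | symm _ _ _ ih => exact hP.symm ih
  | trans _ _ _ _ _ ih ih' => exact hP.trans ih ih'

theorem Linked.of_lacks {d : Atom} (hP : ∀ x y, P x y → Linked f x y) {x y : V}
    (h : Lacks f P d x y) : Linked f x y := by
  have hE := Linked.equivalence f
  obtain ⟨i, k, hi, hk, h⟩ := h
  refine hE.trans (hP _ _ hi) (hE.trans ?_ (hE.symm (hP _ _ hk)))
  rcases h with h | h
  · exact Linked.of_ne fun h' => h (h' ▸ Finset.mem_univ d)
  · exact hE.symm (Linked.of_ne fun h' => h (h' ▸ Finset.mem_univ d))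

/-- If no colour can be used to split the network any more, then it is colourable if and only if
all of the labels contain the identity atom. -/
theorem colorable_iff_of_relax_eq [Finite V]
    (h : ∀ c ≠ Atom.e, ∃ s t P, s ≠ c ∧ t ≠ c ∧ s ≠ t ∧ s ≠ Atom.e ∧ t ≠ Atom.e ∧
      IsFinestSplitting f s t P ∧ relax f P = f) :
    Colorable f ↔ ∀ x y, Atom.e ∈ f x y := by
  classical
  cases nonempty_fintype V
  refine ⟨?_, fun h => ⟨fun _ _ => Atom.e, ⟨fun _ => rfl, fun _ _ => rfl, fun _ _ _ => by decide⟩,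
    h⟩⟩
  rintro ⟨g, hg, hf⟩ x₀ y₀
  by_contra hne
  have hG := Linked.equivalence f
  have h0 : Linked f x₀ y₀ := Linked.of_ne fun h' => hne (h' ▸ Finset.mem_univ _)
  set W : Finset V := Finset.univ.filter (Linked f x₀) with hWdef
  have hmem : ∀ x, x ∈ W ↔ Linked f x₀ x := by simp [hWdef]
  suffices hconn : ∀ c ≠ Atom.e, ∀ x ∈ W, ∀ y ∈ W, IsColoring.Conn g c W x y by
    have := hg.eq_e_of_connected W hconn x₀ ((hmem _).2 (hG.refl _)) y₀ ((hmem _).2 h0)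
    exact hne (this ▸ hf x₀ y₀)
  intro c hc x hx y hy
  obtain ⟨s, t, P, hsc, htc, hst, hs, ht, hP, hrel⟩ := h c hc
  have hCE := IsColoring.Conn.equivalence g c (W : Set V)
  have hxy : Linked f x y := hG.trans (hG.symm ((hmem x).1 hx)) ((hmem y).1 hy)
  -- Relaxing along `P` changes nothing, so nontrivial labels occur only inside classes of `P`, and
  -- linked elements lie in one class.
  have hPxy : P x y := by
    refine Linked.le_of_forall hP.equivalence (fun x y h' => ?_) hxy
    by_contra hxy
    rw [← hrel, relax, if_neg hxy] at h'
    exact h' rfl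
  have hiff : ∀ {x y}, Linked f x y → (x ∈ W ↔ y ∈ W) := by
    intro x y h
    rw [hmem, hmem]
    exact ⟨fun h' => hG.trans h' h, fun h' => hG.trans h' (hG.symm h)⟩
  -- Refine the linked classes by cutting `W` into its components of colour `c`. This is again a
  -- splitting: between two components `g` is constant with value `s` or `t`, and that value lies in
  -- all labels there. As `P` is finest, `W` must then be connected in `c`.
  have hQ : IsSplitting f s t fun x y => Linked f x y ∧ (x ∈ W → IsColoring.Conn g c W x y) := by
    refine ⟨⟨fun x => ⟨hG.refl x, fun _ => hCE.refl x⟩, fun h => ⟨hG.symm h.1, fun hy =>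
      hCE.symm (h.2 ((hiff h.1).2 hy))⟩, fun h h' => ⟨hG.trans h.1 h'.1, fun hx =>
      hCE.trans (h.2 hx) (h'.2 ((hiff h.1).1 hx))⟩⟩, fun x y hb => ?_⟩
    have hL : Linked f x y := Linked.of_lacks (fun _ _ h => h.1) hb.1
    refine ⟨hL, fun hx => ?_⟩
    by_contra hno
    have hy := (hiff hL).1 hx
    have key : ¬ Lacks f (fun x y => Linked f x y ∧ (x ∈ W → IsColoring.Conn g c W x y))
        (g x y) x y := by
      rintro ⟨i, k, hi, hk, h'⟩
      have hi' := (hiff hi.1).1 hx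
      have h1 := IsColoring.Conn.eq hg (Finset.mem_coe.2 hi') (Finset.mem_coe.2 hy) (hi.2 hx)
        (hk.2 hy) hno
      rw [h1] at h'
      rcases h' with h' | h'
      · exact h' (hf i k)
      · rw [hg.symm] at h'
        exact h' (hf k i)
    have hval : g x y = s ∨ g x y = t := by
      have h1 : ¬ (g x y = c ∨ g x y = Atom.e) :=
        fun h1 => hno (IsColoring.Conn.of_eq hx hy h1)
      revert h1
      generalize g x y = r
      clear * - hsc htc hst hs ht hc
      revert s t c r
      decide
    rcases hval with h1 | h1 <;> rw [h1] at key
    · exact key hb.1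
    · exact key hb.2
  exact (hP.le _ hQ x y hPxy).2 hx

end Splitting

/-! ### Counting classes -/

section Counting

variable {V : Type*} [Fintype V] [LinearOrder V]

open Classical in
/-- The number of classes of an equivalence relation, counted by their least elements. -/
noncomputable def numClasses (P : V → V → Prop) : ℕ :=
  (Finset.univ.filter fun x => ∀ y, P x y → x ≤ y).card

theorem numClasses_le (P : V → V → Prop) : numClasses P ≤ Fintype.card V :=
  Finset.card_le_univ _

theorem exists_least (P : V → V → Prop) (hP : Equivalence P) (x : V) :
    ∃ y, P x y ∧ ∀ z, P y z → y ≤ z := by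
  classical
  have hne : (Finset.univ.filter fun y => P x y).Nonempty := ⟨x, by simpa using hP.refl x⟩
  refine ⟨(Finset.univ.filter fun y => P x y).min' hne, ?_, fun z hz => Finset.min'_le _ _ ?_⟩
  · have := Finset.min'_mem _ hne
    simpa using this
  · have := Finset.min'_mem _ hne
    simp only [Finset.mem_filter, Finset.mem_univ, true_and] at this ⊢
    exact hP.trans this hz

/-- The least element of a `Q`-class is least in its `P`-class. The two distinct `P`-classes of `x`
and `y` have two least elements, which cannot both be least in their common `Q`-class. -/
theorem numClasses_lt {P Q : V → V → Prop} (hP : Equivalence P) (hQ : Equivalence Q)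
    (hle : ∀ x y, P x y → Q x y) {x y : V} (hxy : Q x y) (hxy' : ¬ P x y) :
    numClasses Q < numClasses P := by
  classical
  refine Finset.card_lt_card (Finset.ssubset_iff_subset_ne.2 ⟨fun z hz => ?_, fun heq => ?_⟩)
  · simp only [Finset.mem_filter, Finset.mem_univ, true_and] at hz ⊢
    exact fun w hw => hz w (hle _ _ hw)
  · obtain ⟨x', hx', hxl⟩ := exists_least P hP x
    obtain ⟨y', hy', hyl⟩ := exists_least P hP y
    have hx : x' ∈ Finset.univ.filter fun x => ∀ y, Q x y → x ≤ y := by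
      rw [heq]; simpa using hxl
    have hy : y' ∈ Finset.univ.filter fun x => ∀ y, Q x y → x ≤ y := by
      rw [heq]; simpa using hyl
    simp only [Finset.mem_filter, Finset.mem_univ, true_and] at hx hy
    have hq : Q x' y' := hQ.trans (hQ.symm (hle _ _ hx')) (hQ.trans hxy (hle _ _ hy'))
    have := le_antisymm (hx y' hq) (hy x' (hQ.symm hq))
    subst this
    exact hxy' (hP.trans hx' (hP.symm hy'))

/-- After relaxing, links are still links of `f` and stay inside classes of `P`. A discarded
nontrivial label linked two elements that are now separated. -/
theorem IsSplitting.numClasses_linked_lt {f : V → V → Finset Atom} {s t : Atom}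
    {P : V → V → Prop} (hP : IsSplitting f s t P) (h : relax f P ≠ f) :
    numClasses (Linked f) < numClasses (Linked (relax f P)) := by
  obtain ⟨x, h⟩ := Function.ne_iff.1 h
  obtain ⟨y, h⟩ := Function.ne_iff.1 h
  have hxy : ¬ P x y := fun hxy => h (if_pos hxy)
  have hf : f x y ≠ Finset.univ := fun hf => h (by rw [relax, if_neg hxy, hf])
  refine numClasses_lt (Linked.equivalence _) (Linked.equivalence _) (fun x y hxy => ?_)
    (Linked.of_ne hf) (fun h' => hxy ?_)
  · refine Linked.le_of_forall (Linked.equivalence _) (fun x y hxy => Linked.of_ne ?_) hxy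
    intro h
    refine hxy ?_
    rw [relax, h, ite_self]
  · refine Linked.le_of_forall hP.equivalence (fun x y hxy => ?_) h'
    by_contra hno
    exact hxy (if_neg hno)

end Counting

/-! ### Computing the finest splitting by merging classes -/

section Merging

variable {V : Type*} {f : V → V → Finset Atom} {s t : Atom} {P Q : V → V → Prop}

/-- Merge the class of `x` with all classes from which it cannot be separated. -/
def merge (f : V → V → Finset Atom) (s t : Atom) (P : V → V → Prop) (x i j : V) : Prop :=
  P i j ∨ ((P x i ∨ Blocked f s t P x i) ∧ (P x j ∨ Blocked f s t P x j))

theorem merge_le {x i j : V} (h : P i j) : merge f s t P x i j := Or.inl h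

/-- The elements that are in the class of `x` or blocked from it form a union of classes, since
blocking depends only on classes. -/
theorem merge_equivalence (hP : Equivalence P) (x : V) : Equivalence (merge f s t P x) := by
  have key : ∀ {i j}, P i j → (P x i ∨ Blocked f s t P x i) → (P x j ∨ Blocked f s t P x j) := by
    rintro i j hij (h | h)
    · exact Or.inl (hP.trans h hij)
    · exact Or.inr (h.congr hP (hP.refl x) hij)
  refine ⟨fun i => Or.inl (hP.refl i), ?_, ?_⟩
  · rintro i j (h | h)
    · exact Or.inl (hP.symm h)
    · exact Or.inr h.symm
  · rintro i j k (h | h) (h' | h')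
    · exact Or.inl (hP.trans h h')
    · exact Or.inr ⟨key (hP.symm h) h'.1, h'.2⟩
    · exact Or.inr ⟨h.1, key h' h.2⟩
    · exact Or.inr ⟨h.1, h'.2⟩

/-- Blocking is monotone in the relation: what is blocked for `P` is blocked for any coarser `Q`,
and hence joined by `Q` if that is a splitting. So merges are forced, which is why the procedure
ends in the finest splitting. -/
theorem merge_le_of_isSplitting (hQ : IsSplitting f s t Q)
    (hle : ∀ x y, P x y → Q x y) {x i j : V} (h : merge f s t P x i j) : Q i j := by
  have key : ∀ {i}, (P x i ∨ Blocked f s t P x i) → Q x i := by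
    rintro i (h | h)
    · exact hle _ _ h
    · exact hQ.of_blocked _ _ (h.mono (fun _ => hle _ _) (fun _ => hle _ _))
  rcases h with h | h
  · exact hle _ _ h
  · exact hQ.equivalence.trans (hQ.equivalence.symm (key h.1)) (key h.2)

/-- The invariant of the merging procedure with pivot `x`, where the elements with `T` have not been
pivots yet. -/
structure MergeInv (f : V → V → Finset Atom) (s t : Atom) (P : V → V → Prop) (T : V → Prop)
    (x : V) : Prop where
  equivalence : Equivalence P
  le : ∀ Q, IsSplitting f s t Q → ∀ x y, P x y → Q x y
  settled : ∀ y, ¬ T y → ∀ i, Blocked f s t P y i → P y i ∨ P x y ∨ P x i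

variable {T : V → Prop} {x : V}

/-- Only the pivot's class grows. A blocked pair with neither side in that class was therefore
blocked before the merge. -/
theorem MergeInv.merge (h : MergeInv f s t P T x) : MergeInv f s t (merge f s t P x) T x where
  equivalence := merge_equivalence h.equivalence x
  le Q hQ _ _ hxy := merge_le_of_isSplitting hQ (h.le Q hQ) hxy
  settled y hy i hb := by
    by_cases hZy : P x y ∨ Blocked f s t P x y
    · exact Or.inr (Or.inl (Or.inr ⟨Or.inl (h.equivalence.refl x), hZy⟩))
    · by_cases hZi : P x i ∨ Blocked f s t P x i
      · exact Or.inr (Or.inr (Or.inr ⟨Or.inl (h.equivalence.refl x), hZi⟩))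
      · have : Blocked f s t P y i :=
          hb.mono (fun k hk => hk.resolve_right fun h' => hZy h'.1)
            (fun k hk => hk.resolve_right fun h' => hZi h'.1)
        rcases h.settled y hy i this with h' | h' | h'
        · exact Or.inl (Or.inl h')
        · exact absurd (Or.inl h') hZy
        · exact absurd (Or.inl h') hZi

/-- The exceptions in `settled` all involve the pivot's class, and they disappear once that class is
blocked from no other. -/
theorem MergeInv.settled_of_forall (h : MergeInv f s t P T x)
    (hx : ∀ i, Blocked f s t P x i → P x i) :
    ∀ y, ¬ T y → ∀ i, Blocked f s t P y i → P y i := by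
  have hE := h.equivalence
  intro y hy i hb
  rcases h.settled y hy i hb with h' | h' | h'
  · exact h'
  · exact hE.trans (hE.symm h') (hx i (hb.congr hE (hE.symm h') (hE.refl i)))
  · exact hE.symm (hE.trans (hE.symm h') (hx y (hb.symm.congr hE (hE.symm h') (hE.refl y))))

theorem merge_eq_of_forall (hP : Equivalence P) (hx : ∀ i, Blocked f s t P x i → P x i) :
    merge f s t P x = P := by
  funext i j
  refine propext ⟨?_, merge_le⟩
  have key : ∀ {i}, (P x i ∨ Blocked f s t P x i) → P x i := fun h => h.elim id (hx _)
  rintro (h | h)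
  · exact h
  · exact hP.trans (hP.symm (key h.1)) (key h.2)

/-- The current pivot already counts as processed; the exceptions in `settled` excuse it while its
class is still growing. -/
theorem MergeInv.init (x : V) : MergeInv f s t Eq (fun y => y ≠ x) x where
  equivalence := eq_equivalence
  le _ hQ i _ h := h ▸ hQ.equivalence.refl i
  settled _ hy _ _ := Or.inr (Or.inl (not_not.1 hy).symm)

theorem MergeInv.next (h : MergeInv f s t P T x)
    (hx : ∀ i, Blocked f s t P x i → P x i) (y : V) :
    MergeInv f s t P (fun z => T z ∧ z ≠ y) y where
  equivalence := h.equivalence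
  le := h.le
  settled z hz i hb := by
    by_cases hT : T z
    · obtain rfl : z = y := by tauto
      exact Or.inr (Or.inl (h.equivalence.refl z))
    · exact Or.inl (h.settled_of_forall hx z hT i hb)

theorem MergeInv.isFinestSplitting (h : MergeInv f s t P T x)
    (hx : ∀ i, Blocked f s t P x i → P x i) (hT : ∀ y, ¬ T y) : IsFinestSplitting f s t P where
  equivalence := h.equivalence
  of_blocked y i := h.settled_of_forall hx y (hT y) i
  le := h.le

end Merging

/-! ### While programs over finitely many stacks -/

section Programs

variable {K : Type} [DecidableEq K] (Γ : K → Type) (σ : Type)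

/-- Elementary operations on stacks and on the finite store. -/
inductive StackOp : Type
  | push (k : K) (f : σ → Γ k)
  | pop (k : K) (f : σ → Option (Γ k) → σ)
  | load (f : σ → σ)

/-- While programs over stacks. -/
inductive Prog : Type
  | block (l : List (StackOp Γ σ))
  | seq (p q : Prog)
  | ite (f : σ → Bool) (p q : Prog)
  | loop (f : σ → Bool) (p : Prog)

variable {Γ σ}

namespace StackOp

/-- The effect of an elementary operation. -/
def run : StackOp Γ σ → σ × (∀ k, List (Γ k)) → σ × (∀ k, List (Γ k))
  | push k f, (v, S) => (v, Function.update S k (f v :: S k))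
  | pop k f, (v, S) => (f v (S k).head?, Function.update S k (S k).tail)
  | load f, (v, S) => (f v, S)

/-- The effect of a list of elementary operations. -/
def runList (l : List (StackOp Γ σ)) (c : σ × (∀ k, List (Γ k))) : σ × (∀ k, List (Γ k)) :=
  l.foldl (fun c o => o.run c) c

/-- The machine statement for an elementary operation. -/
def toStmt {L : Type} : StackOp Γ σ → TM2.Stmt Γ L σ → TM2.Stmt Γ L σ
  | push k f => TM2.Stmt.push k f
  | pop k f => TM2.Stmt.pop k f
  | load f => TM2.Stmt.load f

/-- A machine statement runs on until its jump, so a whole block of operations costs a single step.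
-/
theorem stepAux_foldr {L : Type} (l : List (StackOp Γ σ)) (cont : L)
    (c : σ × (∀ k, List (Γ k))) :
    TM2.stepAux (l.foldr toStmt (TM2.Stmt.goto fun _ => cont)) c.1 c.2 =
      ⟨some cont, (runList l c).1, (runList l c).2⟩ := by
  induction l generalizing c with
  | nil => rfl
  | cons o l ih =>
    have h := ih (o.run c)
    rw [List.foldr_cons]
    change _ = (⟨some cont, (runList l (o.run c)).1, (runList l (o.run c)).2⟩ : TM2.Cfg Γ L σ)
    rw [← h]
    cases o <;> rfl

end StackOp

/-! ### Compilation of while programs to machines -/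

namespace Prog

/-- The positions of a program. -/
def Label : Prog Γ σ → Type
  | block _ => Unit
  | seq p q => p.Label ⊕ q.Label
  | ite _ p q => Option (p.Label ⊕ q.Label)
  | loop _ p => Option p.Label

/-- The initial position. -/
def entry : (p : Prog Γ σ) → p.Label
  | block _ => ()
  | seq p _ => Sum.inl p.entry
  | ite _ _ _ => none
  | loop _ _ => none

noncomputable instance fintypeLabel : (p : Prog Γ σ) → Fintype p.Label
  | block _ => inferInstanceAs (Fintype Unit)
  | seq p q => @instFintypeSum _ _ (fintypeLabel p) (fintypeLabel q)
  | ite _ p q => @instFintypeOption _ (@instFintypeSum _ _ (fintypeLabel p) (fintypeLabel q))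
  | loop _ p => @instFintypeOption _ (fintypeLabel p)

/-- The machine statement at a position, where the program is continued at `cont`. -/
def compile {L : Type} : (p : Prog Γ σ) → (p.Label → L) → L → p.Label → TM2.Stmt Γ L σ
  | block l, _, cont, _ => l.foldr StackOp.toStmt (TM2.Stmt.goto fun _ => cont)
  | seq p q, emb, _, Sum.inl l =>
    p.compile (fun l => emb (Sum.inl l)) (emb (Sum.inr q.entry)) l
  | seq _ q, emb, cont, Sum.inr l => q.compile (fun l => emb (Sum.inr l)) cont l
  | ite f p q, emb, _, none =>
    TM2.Stmt.branch f (TM2.Stmt.goto fun _ => emb (some (Sum.inl p.entry)))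
      (TM2.Stmt.goto fun _ => emb (some (Sum.inr q.entry)))
  | ite _ p _, emb, cont, some (Sum.inl l) =>
    p.compile (fun l => emb (some (Sum.inl l))) cont l
  | ite _ _ q, emb, cont, some (Sum.inr l) =>
    q.compile (fun l => emb (some (Sum.inr l))) cont l
  | loop f p, emb, cont, none =>
    TM2.Stmt.branch f (TM2.Stmt.goto fun _ => emb (some p.entry)) (TM2.Stmt.goto fun _ => cont)
  | loop _ p, emb, _, some l => p.compile (fun l => emb (some l)) (emb none) l

/-- The machine gets from one configuration to another one in at most `n` steps. -/
def StepsTo {L : Type} (M : L → TM2.Stmt Γ L σ) (a b : TM2.Cfg Γ L σ) (n : ℕ) : Prop :=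
  ∃ k ≤ n, (flip bind (TM2.step M))^[k] (some a) = some b

theorem StepsTo.trans {L : Type} {M : L → TM2.Stmt Γ L σ} {a b c : TM2.Cfg Γ L σ} {n n' : ℕ}
    (h : StepsTo M a b n) (h' : StepsTo M b c n') : StepsTo M a c (n + n') := by
  obtain ⟨k, hk, h⟩ := h
  obtain ⟨k', hk', h'⟩ := h'
  refine ⟨k' + k, by omega, ?_⟩
  rw [Function.iterate_add_apply, h, h']

theorem StepsTo.single {L : Type} {M : L → TM2.Stmt Γ L σ} {a b : TM2.Cfg Γ L σ}
    (h : TM2.step M a = some b) : StepsTo M a b 1 :=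
  ⟨1, le_rfl, h⟩

/-- The program transforms one state into another one within `n` steps. -/
def Runs (p : Prog Γ σ) (c c' : σ × (∀ k, List (Γ k))) (n : ℕ) : Prop :=
  ∀ (L : Type) (M : L → TM2.Stmt Γ L σ) (emb : p.Label → L) (cont : L),
    (∀ l, M (emb l) = p.compile emb cont l) →
      StepsTo M ⟨some (emb p.entry), c.1, c.2⟩ ⟨some cont, c'.1, c'.2⟩ n

variable {p q : Prog Γ σ} {c c' c'' : σ × (∀ k, List (Γ k))} {n n' : ℕ} {f : σ → Bool}

theorem Runs.mono (h : Runs p c c' n) (hn : n ≤ n') : Runs p c c' n' := by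
  intro L M emb cont hM
  obtain ⟨k, hk, h⟩ := h L M emb cont hM
  exact ⟨k, hk.trans hn, h⟩

theorem runs_block (l : List (StackOp Γ σ)) (c : σ × (∀ k, List (Γ k))) :
    Runs (block l) c (StackOp.runList l c) 1 := by
  intro L M emb cont hM
  refine StepsTo.single ?_
  rw [TM2.step, hM]
  exact congrArg some (StackOp.stepAux_foldr l cont c)

/-- Because `Runs` quantifies over all machines that contain the program, each part can be executed
in place, with the entry of the second part as continuation of the first. -/
theorem Runs.seq (h : Runs p c c' n) (h' : Runs q c' c'' n') :
    Runs (p.seq q) c c'' (n + n') := by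
  intro L M emb cont hM
  exact (h L M (fun l => emb (Sum.inl l)) (emb (Sum.inr q.entry)) fun l => hM (Sum.inl l)).trans
    (h' L M (fun l => emb (Sum.inr l)) cont fun l => hM (Sum.inr l))

theorem Runs.ite_true (hf : f c.1 = true) (h : Runs p c c' n) :
    Runs (ite f p q) c c' (1 + n) := by
  intro L M emb cont hM
  refine StepsTo.trans (StepsTo.single ?_)
    (h L M (fun l => emb (some (Sum.inl l))) cont fun l => hM (some (Sum.inl l)))
  rw [TM2.step, hM]
  simp [entry, compile, hf]

theorem Runs.ite_false (hf : f c.1 = false) (h : Runs q c c' n) :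
    Runs (ite f p q) c c' (1 + n) := by
  intro L M emb cont hM
  refine StepsTo.trans (StepsTo.single ?_)
    (h L M (fun l => emb (some (Sum.inr l))) cont fun l => hM (some (Sum.inr l)))
  rw [TM2.step, hM]
  simp [entry, compile, hf]

theorem Runs.loop_false (hf : f c.1 = false) : Runs (loop f p) c c 1 := by
  intro L M emb cont hM
  refine StepsTo.single ?_
  rw [TM2.step, hM]
  simp [entry, compile, hf]

theorem Runs.loop_true (hf : f c.1 = true) (h : Runs p c c' n) (h' : Runs (loop f p) c' c'' n') :
    Runs (loop f p) c c'' (1 + n + n') := by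
  intro L M emb cont hM
  refine StepsTo.trans (StepsTo.trans (StepsTo.single ?_)
    (h L M (fun l => emb (some l)) (emb none) fun l => hM (some l))) (h' L M emb cont hM)
  rw [TM2.step, hM]
  simp [entry, compile, hf]

/-- The machine that executes a program and halts. -/
def machine (p : Prog Γ σ) : Option p.Label → TM2.Stmt Γ (Option p.Label) σ
  | none => TM2.Stmt.halt
  | some l => p.compile some none l

/-- The additional step executes the halt statement at the final position. -/
theorem Runs.machine (h : Runs p c c' n) :
    StepsTo p.machine ⟨some (some p.entry), c.1, c.2⟩ ⟨none, c'.1, c'.2⟩ (n + 1) :=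
  (h _ p.machine some none fun _ => rfl).trans (StepsTo.single rfl)

end Prog

end Programs

/-! ### Matrix machines -/

/-- A cell of the matrix: a label, whether the cell is on the diagonal, and whether its row and
column are in the same class. -/
structure Cell : Type where
  lab : Finset Atom
  diag : Bool
  same : Bool
  deriving Fintype

/-- Marks of the rows and columns. -/
structure Mark : Type where
  todo : Bool
  pivot : Bool
  sel : Bool
  lackS : Bool
  lackT : Bool
  classS : Bool
  classT : Bool

instance : Finite Mark :=
  Finite.of_injective (fun k : Mark => (k.todo, k.pivot, k.sel, k.lackS, k.lackT, k.classS,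
    k.classT)) fun k k' h => by cases k; cases k'; simp_all

/-- The flags that control the program. -/
structure Flags : Type where
  active : Bool
  changed : Bool
  relaxed : Bool
  bad : Bool
  deriving Fintype

instance : Inhabited Cell := ⟨⟨∅, false, false⟩⟩
instance : Inhabited Mark := ⟨⟨false, false, false, false, false, false, false⟩⟩
instance : Inhabited Flags := ⟨⟨false, false, false, false⟩⟩

/-- The finite store of the machine: the flags, and registers for symbols of the stacks. -/
structure Store : Type where
  q : Flags
  x : Option Cell
  c : Option Mark
  r : Option Mark
  inp : Option (Option (Finset Atom))

instance : Finite Store :=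
  Finite.of_injective (fun v : Store => (v.q, v.x, v.c, v.r, v.inp)) fun v v' h => by
    cases v; cases v'; simp_all

noncomputable instance : Fintype Store := Fintype.ofFinite Store

/-- The stacks: input and output, the matrix, the marks of the columns, the marks of the rows, and
copies for traversing them. -/
inductive Stack : Type
  | inp | out | m | m' | c | c' | r | r'
  deriving DecidableEq

instance : Fintype Stack where
  elems := {.inp, .out, .m, .m', .c, .c', .r, .r'}
  complete := by intro x; cases x <;> decide

/-- The alphabets of the stacks. -/
def Stack.Sym : Stack → Type
  | inp => Option (Finset Atom)
  | out => Bool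
  | m => Cell
  | m' => Cell
  | c => Mark
  | c' => Mark
  | r => Mark
  | r' => Mark

/-- The contents of the stacks. -/
structure Tapes : Type where
  inp : List (Option (Finset Atom)) := []
  out : List Bool := []
  m : List Cell := []
  m' : List Cell := []
  c : List Mark := []
  c' : List Mark := []
  r : List Mark := []
  r' : List Mark := []

namespace Tapes

/-- The contents of the stacks as a dependent function. -/
def get (t : Tapes) : ∀ k : Stack, List k.Sym
  | .inp => t.inp
  | .out => t.out
  | .m => t.m
  | .m' => t.m'
  | .c => t.c
  | .c' => t.c'
  | .r => t.r
  | .r' => t.r'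

variable (t : Tapes)

theorem update_inp (l) : Function.update t.get .inp l = get { t with inp := l } := by
  funext k; cases k <;> rfl

theorem update_out (l) : Function.update t.get .out l = get { t with out := l } := by
  funext k; cases k <;> rfl

theorem update_m (l) : Function.update t.get .m l = get { t with m := l } := by
  funext k; cases k <;> rfl

theorem update_m' (l) : Function.update t.get .m' l = get { t with m' := l } := by
  funext k; cases k <;> rfl

theorem update_c (l) : Function.update t.get .c l = get { t with c := l } := by
  funext k; cases k <;> rfl

theorem update_c' (l) : Function.update t.get .c' l = get { t with c' := l } := by
  funext k; cases k <;> rfl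

theorem update_r (l) : Function.update t.get .r l = get { t with r := l } := by
  funext k; cases k <;> rfl

theorem update_r' (l) : Function.update t.get .r' l = get { t with r' := l } := by
  funext k; cases k <;> rfl

end Tapes

/-- Programs of the matrix machine. -/
abbrev MProg : Type := Prog Stack.Sym Store

namespace MProg

open Prog StackOp

/-- A program transforms one store and stacks into others within `n` steps. -/
def Exec (p : MProg) (v : Store) (t : Tapes) (v' : Store) (t' : Tapes) (n : ℕ) : Prop :=
  Prog.Runs p (v, t.get) (v', t'.get) n

section Rules

variable {p q : MProg} {v v' v'' : Store} {t t' t'' : Tapes} {n n' : ℕ} {f : Store → Bool}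

theorem Exec.mono (h : Exec p v t v' t' n) (hn : n ≤ n') : Exec p v t v' t' n' := Runs.mono h hn

theorem Exec.seq (h : Exec p v t v' t' n) (h' : Exec q v' t' v'' t'' n') :
    Exec (p.seq q) v t v'' t'' (n + n') := Runs.seq h h'

theorem Exec.ite_true (hf : f v = true) (h : Exec p v t v' t' n) :
    Exec (ite f p q) v t v' t' (1 + n) := Runs.ite_true hf h

theorem Exec.ite_false (hf : f v = false) (h : Exec q v t v' t' n) :
    Exec (ite f p q) v t v' t' (1 + n) := Runs.ite_false hf h

theorem Exec.loop_false (hf : f v = false) : Exec (loop f p) v t v t 1 := Runs.loop_false hf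

theorem Exec.loop_true (hf : f v = true) (h : Exec p v t v' t' n)
    (h' : Exec (loop f p) v' t' v'' t'' n') : Exec (loop f p) v t v'' t'' (1 + n + n') :=
  Runs.loop_true hf h h'

theorem Exec.block {l : List (StackOp Stack.Sym Store)}
    (h : StackOp.runList l (v, t.get) = (v', t'.get)) : Exec (Prog.block l) v t v' t' 1 := by
  have := runs_block l (v, t.get)
  rwa [h] at this

end Rules

/-- Put the top of a stack into its register. -/
def popM : StackOp Stack.Sym Store := .pop .m fun v x => { v with x := x }
/-- Put the top of a stack into its register. -/
def popM' : StackOp Stack.Sym Store := .pop .m' fun v x => { v with x := x }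
/-- Put the top of a stack into its register. -/
def popC : StackOp Stack.Sym Store := .pop .c fun v x => { v with c := x }
/-- Put the top of a stack into its register. -/
def popC' : StackOp Stack.Sym Store := .pop .c' fun v x => { v with c := x }
/-- Put the top of a stack into its register. -/
def popR : StackOp Stack.Sym Store := .pop .r fun v x => { v with r := x }
/-- Put the top of a stack into its register. -/
def popR' : StackOp Stack.Sym Store := .pop .r' fun v x => { v with r := x }
/-- Put the top of a stack into its register. -/
def popInp : StackOp Stack.Sym Store := .pop .inp fun v x => { v with inp := x }
/-- Write a register to a stack. -/
def pushM : StackOp Stack.Sym Store := .push .m fun v => (v.x.getD default : Cell)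
/-- Write a register to a stack. -/
def pushM' : StackOp Stack.Sym Store := .push .m' fun v => (v.x.getD default : Cell)
/-- Write a register to a stack. -/
def pushC : StackOp Stack.Sym Store := .push .c fun v => (v.c.getD default : Mark)
/-- Write a register to a stack. -/
def pushC' : StackOp Stack.Sym Store := .push .c' fun v => (v.c.getD default : Mark)
/-- Write a register to a stack. -/
def pushR : StackOp Stack.Sym Store := .push .r fun v => (v.r.getD default : Mark)
/-- Write a register to a stack. -/
def pushR' : StackOp Stack.Sym Store := .push .r' fun v => (v.r.getD default : Mark)

section Ops

variable (v : Store) (t : Tapes) (l : List (StackOp Stack.Sym Store))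

theorem runList_nil (c : Store × (∀ k : Stack, List k.Sym)) :
    runList ([] : List (StackOp Stack.Sym Store)) c = c := rfl

theorem runList_popM : runList (popM :: l) (v, t.get) =
    runList l ({ v with x := t.m.head? }, Tapes.get { t with m := t.m.tail }) :=
  congrArg (fun S => runList l (({ v with x := t.m.head? } : Store), S)) (t.update_m _)

theorem runList_popM' : runList (popM' :: l) (v, t.get) =
    runList l ({ v with x := t.m'.head? }, Tapes.get { t with m' := t.m'.tail }) :=
  congrArg (fun S => runList l (({ v with x := t.m'.head? } : Store), S)) (t.update_m' _)

theorem runList_popC : runList (popC :: l) (v, t.get) =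
    runList l ({ v with c := t.c.head? }, Tapes.get { t with c := t.c.tail }) :=
  congrArg (fun S => runList l (({ v with c := t.c.head? } : Store), S)) (t.update_c _)

theorem runList_popC' : runList (popC' :: l) (v, t.get) =
    runList l ({ v with c := t.c'.head? }, Tapes.get { t with c' := t.c'.tail }) :=
  congrArg (fun S => runList l (({ v with c := t.c'.head? } : Store), S)) (t.update_c' _)

theorem runList_popR : runList (popR :: l) (v, t.get) =
    runList l ({ v with r := t.r.head? }, Tapes.get { t with r := t.r.tail }) :=
  congrArg (fun S => runList l (({ v with r := t.r.head? } : Store), S)) (t.update_r _)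

theorem runList_popR' : runList (popR' :: l) (v, t.get) =
    runList l ({ v with r := t.r'.head? }, Tapes.get { t with r' := t.r'.tail }) :=
  congrArg (fun S => runList l (({ v with r := t.r'.head? } : Store), S)) (t.update_r' _)

theorem runList_popInp : runList (popInp :: l) (v, t.get) =
    runList l ({ v with inp := t.inp.head? }, Tapes.get { t with inp := t.inp.tail }) :=
  congrArg (fun S => runList l (({ v with inp := t.inp.head? } : Store), S)) (t.update_inp _)

theorem runList_pushM : runList (pushM :: l) (v, t.get) =
    runList l (v, Tapes.get { t with m := v.x.getD default :: t.m }) :=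
  congrArg (fun S => runList l (v, S)) (t.update_m _)

theorem runList_pushM' : runList (pushM' :: l) (v, t.get) =
    runList l (v, Tapes.get { t with m' := v.x.getD default :: t.m' }) :=
  congrArg (fun S => runList l (v, S)) (t.update_m' _)

theorem runList_pushC : runList (pushC :: l) (v, t.get) =
    runList l (v, Tapes.get { t with c := v.c.getD default :: t.c }) :=
  congrArg (fun S => runList l (v, S)) (t.update_c _)

theorem runList_pushC' : runList (pushC' :: l) (v, t.get) =
    runList l (v, Tapes.get { t with c' := v.c.getD default :: t.c' }) :=
  congrArg (fun S => runList l (v, S)) (t.update_c' _)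

theorem runList_pushR : runList (pushR :: l) (v, t.get) =
    runList l (v, Tapes.get { t with r := v.r.getD default :: t.r }) :=
  congrArg (fun S => runList l (v, S)) (t.update_r _)

theorem runList_pushR' : runList (pushR' :: l) (v, t.get) =
    runList l (v, Tapes.get { t with r' := v.r.getD default :: t.r' }) :=
  congrArg (fun S => runList l (v, S)) (t.update_r' _)

theorem runList_load (f : Store → Store) : runList (.load f :: l) (v, t.get) =
    runList l (f v, t.get) := rfl

theorem runList_pushOut (f : Store → Bool) : runList (.push .out f :: l) (v, t.get) =
    runList l (v, Tapes.get { t with out := f v :: t.out }) :=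
  congrArg (fun S => runList l (v, S)) (t.update_out _)

end Ops

/-- Rewind the matrix. -/
def rewindM : MProg :=
  (Prog.block [popM']).seq (.loop (fun v => v.x.isSome) (.block [pushM, popM']))

/-- Rewind the marks of the columns. -/
def rewindC : MProg :=
  (Prog.block [popC']).seq (.loop (fun v => v.c.isSome) (.block [pushC, popC']))

/-- Rewind the marks of the rows. -/
def rewindR : MProg :=
  (Prog.block [popR']).seq (.loop (fun v => v.r.isSome) (.block [pushR, popR']))

theorem rewindM_exec (v : Store) (t : Tapes) :
    Exec rewindM v t { v with x := none } { t with m := t.m'.reverse ++ t.m, m' := [] }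
      (2 * t.m'.length + 2) := by
  -- Loop invariant: the unread symbols are `l`, whose head is already in the register. The test and
  -- the block cost two steps per symbol.
  suffices h : ∀ (l a : List Cell),
      Exec (.loop (fun v => v.x.isSome) (.block [pushM, popM'])) { v with x := l.head? }
        { t with m := a, m' := l.tail } { v with x := none }
        { t with m := l.reverse ++ a, m' := [] } (2 * l.length + 1) by
    refine Exec.mono (Exec.seq (Exec.block ?_) (h t.m' t.m)) (by omega)
    rw [runList_popM', runList_nil]
  intro l
  induction l with
  | nil => exact fun a => Exec.loop_false rfl
  | cons y l ih =>
    intro a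
    refine Exec.mono (Exec.loop_true rfl (Exec.block ?_) (by simpa using ih (y :: a)))
      (n := 1 + 1 + (2 * l.length + 1)) (by simp; omega)
    rw [runList_pushM, runList_popM', runList_nil]
    rfl

theorem rewindC_exec (v : Store) (t : Tapes) :
    Exec rewindC v t { v with c := none } { t with c := t.c'.reverse ++ t.c, c' := [] }
      (2 * t.c'.length + 2) := by
  suffices h : ∀ (l a : List Mark),
      Exec (.loop (fun v => v.c.isSome) (.block [pushC, popC'])) { v with c := l.head? }
        { t with c := a, c' := l.tail } { v with c := none }
        { t with c := l.reverse ++ a, c' := [] } (2 * l.length + 1) by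
    refine Exec.mono (Exec.seq (Exec.block ?_) (h t.c' t.c)) (by omega)
    rw [runList_popC', runList_nil]
  intro l
  induction l with
  | nil => exact fun a => Exec.loop_false rfl
  | cons y l ih =>
    intro a
    refine Exec.mono (Exec.loop_true rfl (Exec.block ?_) (by simpa using ih (y :: a)))
      (n := 1 + 1 + (2 * l.length + 1)) (by simp; omega)
    rw [runList_pushC, runList_popC', runList_nil]
    rfl

theorem rewindR_exec (v : Store) (t : Tapes) :
    Exec rewindR v t { v with r := none } { t with r := t.r'.reverse ++ t.r, r' := [] }
      (2 * t.r'.length + 2) := by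
  suffices h : ∀ (l a : List Mark),
      Exec (.loop (fun v => v.r.isSome) (.block [pushR, popR'])) { v with r := l.head? }
        { t with r := a, r' := l.tail } { v with r := none }
        { t with r := l.reverse ++ a, r' := [] } (2 * l.length + 1) by
    refine Exec.mono (Exec.seq (Exec.block ?_) (h t.r' t.r)) (by omega)
    rw [runList_popR', runList_nil]
  intro l
  induction l with
  | nil => exact fun a => Exec.loop_false rfl
  | cons y l ih =>
    intro a
    refine Exec.mono (Exec.loop_true rfl (Exec.block ?_) (by simpa using ih (y :: a)))
      (n := 1 + 1 + (2 * l.length + 1)) (by simp; omega)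
    rw [runList_pushR, runList_popR', runList_nil]
    rfl

end MProg

/-! ### Sweeps through the matrix -/

/-- What the machine sees at a cell: the flags, the cell, and the marks of its column and row. -/
structure View : Type where
  q : Flags
  x : Cell
  c : Mark
  r : Mark

/-- The data of the machine, indexed by the rows and columns. -/
@[ext]
structure Data (ι : Type) : Type where
  q : Flags
  M : ι → ι → Cell
  C : ι → Mark
  R : ι → Mark

namespace Data

variable {ι : Type} [DecidableEq ι] (δ : View → View)

/-- What is seen at a cell. -/
def view (s : Data ι) (i j : ι) : View := ⟨s.q, s.M i j, s.C j, s.R i⟩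

/-- Apply a transformation at a cell. -/
def act (s : Data ι) (i j : ι) : Data ι where
  q := (δ (s.view i j)).q
  M := Function.update s.M i (Function.update (s.M i) j (δ (s.view i j)).x)
  C := Function.update s.C j (δ (s.view i j)).c
  R := Function.update s.R i (δ (s.view i j)).r

/-- Apply a transformation along a row. -/
def actRow (i : ι) (js : List ι) (s : Data ι) : Data ι :=
  js.foldl (fun s j => s.act δ i j) s

/-- Apply a transformation along several rows. -/
def actRows (js is : List ι) (s : Data ι) : Data ι :=
  is.foldl (fun s i => s.actRow δ i js) s

variable {δ}

theorem actRow_C {i : ι} {js : List ι} {s : Data ι} {j : ι} (hj : j ∉ js) :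
    (s.actRow δ i js).C j = s.C j := by
  induction js generalizing s with
  | nil => rfl
  | cons k js ih =>
    rw [List.mem_cons, not_or] at hj
    change ((s.act δ i k).actRow δ i js).C j = _
    rw [ih hj.2]
    exact Function.update_of_ne hj.1 _ _

theorem actRow_M {i : ι} {js : List ι} {s : Data ι} {j : ι} (hj : j ∉ js) :
    (s.actRow δ i js).M i j = s.M i j := by
  induction js generalizing s with
  | nil => rfl
  | cons k js ih =>
    rw [List.mem_cons, not_or] at hj
    change ((s.act δ i k).actRow δ i js).M i j = _
    rw [ih hj.2]
    simp only [act, Function.update_self]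
    exact Function.update_of_ne hj.1 _ _

theorem actRow_M_ne {i i' : ι} {js : List ι} {s : Data ι} (hi : i' ≠ i) :
    (s.actRow δ i js).M i' = s.M i' := by
  induction js generalizing s with
  | nil => rfl
  | cons k js ih =>
    change ((s.act δ i k).actRow δ i js).M i' = _
    rw [ih]
    exact Function.update_of_ne hi _ _

theorem actRow_R_ne {i i' : ι} {js : List ι} {s : Data ι} (hi : i' ≠ i) :
    (s.actRow δ i js).R i' = s.R i' := by
  induction js generalizing s with
  | nil => rfl
  | cons k js ih =>
    change ((s.act δ i k).actRow δ i js).R i' = _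
    rw [ih]
    exact Function.update_of_ne hi _ _

theorem actRows_M {js is : List ι} {s : Data ι} {i : ι} (hi : i ∉ is) :
    (s.actRows δ js is).M i = s.M i := by
  induction is generalizing s with
  | nil => rfl
  | cons k is ih =>
    rw [List.mem_cons, not_or] at hi
    change ((s.actRow δ k js).actRows δ js is).M i = _
    rw [ih hi.2, actRow_M_ne hi.1]

theorem actRows_R {js is : List ι} {s : Data ι} {i : ι} (hi : i ∉ is) :
    (s.actRows δ js is).R i = s.R i := by
  induction is generalizing s with
  | nil => rfl
  | cons k is ih =>
    rw [List.mem_cons, not_or] at hi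
    change ((s.actRow δ k js).actRows δ js is).R i = _
    rw [ih hi.2, actRow_R_ne hi.1]

end Data

namespace MProg

open Prog StackOp Data

/-- Apply a transformation to the registers. -/
def applyView (δ : View → View) (v : Store) : Store :=
  let w := δ ⟨v.q, v.x.getD default, v.c.getD default, v.r.getD default⟩
  { v with q := w.q, x := some w.x, c := some w.c, r := some w.r }

/-- The loop along a row of the matrix. -/
def rowLoop (δ : View → View) : MProg :=
  .loop (fun v => v.c.isSome) (.block [popM, .load (applyView δ), pushM', pushC',
    .load fun v => { v with x := none }, popC])

/-- The loop through the rows of the matrix. -/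
def rowsLoop (δ : View → View) : MProg :=
  .loop (fun v => v.r.isSome) ((Prog.block [popC]).seq ((rowLoop δ).seq (rewindC.seq
    (.block [pushR', popR]))))

/-- Apply a transformation at all cells of the matrix. -/
def sweep (δ : View → View) : MProg :=
  (Prog.block [popR]).seq ((rowsLoop δ).seq (rewindM.seq rewindR))

variable {ι : Type} [DecidableEq ι] (δ : View → View)

/-- The register for column marks controls the loop, while the row mark stays in its register along
the whole row. As `js` has no repetition, the changes made to the matrix and the column mark at one
position do not affect the positions still to be read. -/
theorem rowLoop_exec (i : ι) (js : List ι) (hjs : js.Nodup) (s : Data ι) (t : Tapes)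
    (am : List Cell) (ac : List Mark) :
    Exec (rowLoop δ) ⟨s.q, none, (js.map s.C).head?, some (s.R i), none⟩
      { t with m := js.map (s.M i) ++ t.m, m' := am, c := (js.map s.C).tail, c' := ac }
      ⟨(s.actRow δ i js).q, none, none, some ((s.actRow δ i js).R i), none⟩
      { t with
        m' := (js.map ((s.actRow δ i js).M i)).reverse ++ am
        c := []
        c' := (js.map (s.actRow δ i js).C).reverse ++ ac } (2 * js.length + 1) := by
  induction js generalizing s am ac with
  | nil => exact Exec.loop_false rfl
  | cons j js ih =>
    rw [List.nodup_cons] at hjs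
    have h := ih hjs.2 (s.act δ i j) ((δ (s.view i j)).x :: am) ((δ (s.view i j)).c :: ac)
    have h1 : s.actRow δ i (j :: js) = (s.act δ i j).actRow δ i js := rfl
    have hC : js.map (s.act δ i j).C = js.map s.C := by
      refine List.map_congr_left fun k hk => Function.update_of_ne ?_ _ _
      rintro rfl
      exact hjs.1 hk
    have hM : js.map ((s.act δ i j).M i) = js.map (s.M i) := by
      refine List.map_congr_left fun k hk => ?_
      simp only [act, Function.update_self]
      refine Function.update_of_ne ?_ _ _
      rintro rfl
      exact hjs.1 hk
    have hCj : ((s.act δ i j).actRow δ i js).C j = (δ (s.view i j)).c := by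
      rw [actRow_C hjs.1]
      exact Function.update_self _ _ _
    have hMj : ((s.act δ i j).actRow δ i js).M i j = (δ (s.view i j)).x := by
      rw [actRow_M hjs.1]
      simp only [act, Function.update_self]
    rw [hC, hM] at h
    rw [h1]
    simp only [List.map_cons, List.reverse_cons, List.append_assoc, List.singleton_append,
      hCj, hMj]
    refine Exec.mono (Exec.loop_true rfl (Exec.block ?_) h)
      (n := 1 + 1 + (2 * js.length + 1)) (by simp; omega)
    rw [runList_popM, runList_load, runList_pushM', runList_pushC', runList_load, runList_popC,
      runList_nil]
    simp [applyView, act, view]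

theorem rowsLoop_exec (js is : List ι) (hjs : js.Nodup) (his : is.Nodup) (s : Data ι) (t : Tapes)
    (am : List Cell) (ar : List Mark) :
    Exec (rowsLoop δ) ⟨s.q, none, none, (is.map s.R).head?, none⟩
      { t with
        m := is.flatMap (fun i => js.map (s.M i))
        m' := am
        c := js.map s.C
        c' := []
        r := (is.map s.R).tail
        r' := ar }
      ⟨(s.actRows δ js is).q, none, none, none, none⟩
      { t with
        m := []
        m' := (is.flatMap (fun i => js.map ((s.actRows δ js is).M i))).reverse ++ am
        c := js.map (s.actRows δ js is).C
        c' := []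
        r := []
        r' := (is.map (s.actRows δ js is).R).reverse ++ ar }
      ((4 * js.length + 6) * is.length + 1) := by
  induction is generalizing s am ar with
  | nil => exact Exec.mono (Exec.loop_false rfl) (by omega)
  | cons i is ih =>
    rw [List.nodup_cons] at his
    set s' := s.actRow δ i js with hs'
    have h1 : s.actRows δ js (i :: is) = s'.actRows δ js is := rfl
    have hne : ∀ k ∈ is, k ≠ i := by
      rintro k hk rfl
      exact his.1 hk
    have hR : is.map s'.R = is.map s.R :=
      List.map_congr_left fun k hk => actRow_R_ne (hne k hk)
    have hM : is.flatMap (fun i => js.map (s'.M i)) = is.flatMap (fun i => js.map (s.M i)) :=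
      List.flatMap_congr fun k hk => by rw [hs', actRow_M_ne (hne k hk)]
    have h := ih his.2 s' ((js.map (s'.M i)).reverse ++ am) (s'.R i :: ar)
    rw [hR, hM] at h
    rw [h1]
    have hMi : (s'.actRows δ js is).M i = s'.M i := actRows_M his.1
    have hRi : (s'.actRows δ js is).R i = s'.R i := actRows_R his.1
    have hrow := rowLoop_exec δ i js hjs s { t with
      m := is.flatMap (fun i => js.map (s.M i)), r := is.map s.R, r' := ar } am []
    have hrew := (rewindC_exec ⟨s'.q, none, none, some (s'.R i), none⟩ { t with
        m := is.flatMap (fun i => js.map (s.M i))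
        r := is.map s.R
        r' := ar
        m' := (js.map (s'.M i)).reverse ++ am
        c := []
        c' := (js.map s'.C).reverse ++ [] }).mono (n' := 2 * js.length + 2) (by simp)
    simp only [List.append_nil, List.reverse_reverse] at hrow hrew
    simp only [List.flatMap_cons, List.map_cons, List.reverse_cons, List.reverse_append,
      List.append_assoc, List.singleton_append, hMi, hRi]
    -- One test, one pop, the row loop, the rewinding of the column marks and one final block add up
    -- to `4 * js.length + 6` steps per row.
    refine Exec.mono (Exec.loop_true rfl (Exec.seq (Exec.block ?_) (Exec.seq hrow
      (Exec.seq hrew (Exec.block ?_)))) h)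
      (n := 1 + (1 + (2 * js.length + 1 + (2 * js.length + 2 + 1))) +
        ((4 * js.length + 6) * is.length + 1)) (by rw [List.length_cons]; ring_nf; omega)
    · rw [runList_popC, runList_nil]
      rfl
    · rw [runList_pushR', runList_popR, runList_nil]
      simp

/-- The stacks that hold the data, where `is` lists the rows and columns. -/
def tapes (is : List ι) (s : Data ι) : Tapes where
  m := is.flatMap fun i => is.map (s.M i)
  c := is.map s.C
  r := is.map s.R

/-- A program transforms the data within `n` steps. -/
def Computes (is : List ι) (p : MProg) (s s' : Data ι) (n : ℕ) : Prop :=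
  Exec p ⟨s.q, none, none, none, none⟩ (tapes is s) ⟨s'.q, none, none, none, none⟩ (tapes is s') n

/-- A bound for the time of a sweep. -/
def sweepTime (m : ℕ) : ℕ := 12 * (m + 1) ^ 2

theorem sweep_computes (is : List ι) (his : is.Nodup) (s : Data ι) :
    Computes is (sweep δ) s (s.actRows δ is is) (sweepTime is.length) := by
  set s' := s.actRows δ is is
  have h := rowsLoop_exec δ is is his his s {} [] []
  have h1 := rewindM_exec ⟨s'.q, none, none, none, none⟩
    { m' := (is.flatMap (fun i => is.map (s'.M i))).reverse ++ [], c := is.map s'.C,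
      r' := (is.map s'.R).reverse ++ [] }
  have h2 := rewindR_exec ⟨s'.q, none, none, none, none⟩
    { m := is.flatMap (fun i => is.map (s'.M i)), c := is.map s'.C,
      r' := (is.map s'.R).reverse ++ [] }
  have hlen : (is.flatMap (fun i => is.map (s'.M i))).length = is.length * is.length := by
    simp [List.length_flatMap]
  simp only [List.append_nil, List.length_reverse, hlen, List.length_map, List.reverse_reverse]
    at h h1 h2
  refine Exec.mono (Exec.seq (Exec.block ?_) (Exec.seq h (Exec.seq h1 h2))) ?_
  · rw [runList_popR, runList_nil]
    rfl
  -- The rows, both rewindings and the first pop take `6 * m ^ 2 + 8 * m + 6` steps in all.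
  · unfold sweepTime
    nlinarith

end MProg

/-! ### Sweeps whose result does not depend on the order of the cells -/

/-- A transformation of cells and marks such that the changes of marks are not visible at other
cells. -/
structure LocalRule : Type where
  gq : Cell → Mark → Mark → Flags → Flags
  gx : Cell → Mark → Mark → Cell
  gc : Cell → Mark → Mark → Mark
  gr : Cell → Mark → Mark → Mark
  gq_gc : ∀ x x' r' c r, gq x (gc x' r' c) r = gq x c r
  gq_gr : ∀ x x' c' c r, gq x c (gr x' c' r) = gq x c r
  gx_gc : ∀ x x' r' c r, gx x (gc x' r' c) r = gx x c r
  gx_gr : ∀ x x' c' c r, gx x c (gr x' c' r) = gx x c r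
  gc_gr : ∀ x x' c' r c, gc x (gr x' c' r) c = gc x r c
  gr_gc : ∀ x x' r' c r, gr x (gc x' r' c) r = gr x c r

namespace LocalRule

variable (ρ : LocalRule) {ι : Type} [DecidableEq ι]

/-- The transformation of a view. -/
def onView (w : View) : View :=
  ⟨ρ.gq w.x w.c w.r w.q, ρ.gx w.x w.c w.r, ρ.gc w.x w.r w.c, ρ.gr w.x w.c w.r⟩

/-- The invisibility conditions of a local rule say that updates made by earlier cells do not alter
what later cells contribute, so every update can be computed from the original data. -/
theorem actRow_eq (i : ι) (js : List ι) (hjs : js.Nodup) (s : Data ι) :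
    s.actRow ρ.onView i js =
      { q := js.foldl (fun q j => ρ.gq (s.M i j) (s.C j) (s.R i) q) s.q
        M := fun i' j => if i' = i ∧ j ∈ js then ρ.gx (s.M i j) (s.C j) (s.R i) else s.M i' j
        C := fun j => if j ∈ js then ρ.gc (s.M i j) (s.R i) (s.C j) else s.C j
        R := Function.update s.R i (js.foldl (fun r j => ρ.gr (s.M i j) (s.C j) r) (s.R i)) } := by
  induction js generalizing s with
  | nil => simp [Data.actRow]
  | cons k js ih =>
    rw [List.nodup_cons] at hjs
    change (s.act ρ.onView i k).actRow ρ.onView i js = _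
    rw [ih hjs.2]
    have hk : ∀ j ∈ js, j ≠ k := by
      rintro j hj rfl
      exact hjs.1 hj
    have hM : ∀ j ∈ js, (s.act ρ.onView i k).M i j = s.M i j := fun j hj => by
      simp [Data.act, hk j hj]
    have hC : ∀ j ∈ js, (s.act ρ.onView i k).C j = s.C j := fun j hj => by
      simp [Data.act, hk j hj]
    have hR : (s.act ρ.onView i k).R i = ρ.gr (s.M i k) (s.C k) (s.R i) := by
      simp [Data.act, onView, Data.view]
    ext1
    · simp only [List.foldl_cons]
      rw [List.foldl_ext _ (fun q j => ρ.gq (s.M i j) (s.C j) (s.R i) q)]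
      · rfl
      · intro q j hj
        rw [hM j hj, hC j hj, hR, ρ.gq_gr]
    · funext i' j
      by_cases hi : i' = i
      · subst hi
        by_cases hj : j ∈ js
        · simp only [hj, and_self, if_true, List.mem_cons, or_true]
          rw [hM j hj, hC j hj, hR, ρ.gx_gr]
        · by_cases hjk : j = k
          · subst hjk
            simp [hj, Data.act, onView, Data.view]
          · simp [hj, hjk, Data.act]
      · simp [hi, Data.act]
    · funext j
      by_cases hj : j ∈ js
      · simp only [hj, if_true, List.mem_cons, or_true]
        rw [hM j hj, hC j hj, hR, ρ.gc_gr]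
      · by_cases hjk : j = k
        · subst hjk
          simp [hj, Data.act, onView, Data.view]
        · simp [hj, hjk, Data.act]
    · simp only [List.foldl_cons]
      rw [List.foldl_ext _ (fun r j => ρ.gr (s.M i j) (s.C j) r)]
      · rw [hR]
        simp [Data.act]
      · intro r j hj
        rw [hM j hj, hC j hj]

theorem actRows_eq (js is : List ι) (hjs : js.Nodup) (his : is.Nodup) (hmem : ∀ j, j ∈ js)
    (s : Data ι) :
    s.actRows ρ.onView js is =
      { q := is.foldl (fun q i => js.foldl (fun q j => ρ.gq (s.M i j) (s.C j) (s.R i) q) q) s.q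
        M := fun i j => if i ∈ is then ρ.gx (s.M i j) (s.C j) (s.R i) else s.M i j
        C := fun j => is.foldl (fun c i => ρ.gc (s.M i j) (s.R i) c) (s.C j)
        R := fun i => if i ∈ is then js.foldl (fun r j => ρ.gr (s.M i j) (s.C j) r) (s.R i)
          else s.R i } := by
  induction is generalizing s with
  | nil => simp [Data.actRows]
  | cons k is ih =>
    rw [List.nodup_cons] at his
    change (s.actRow ρ.onView k js).actRows ρ.onView js is = _
    rw [ih his.2, actRow_eq ρ k js hjs]
    have hk : ∀ i ∈ is, i ≠ k := by
      rintro i hi rfl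
      exact his.1 hi
    simp only [hmem, if_true, and_true]
    ext1
    · simp only [List.foldl_cons]
      refine List.foldl_ext _ _ _ fun q i hi => List.foldl_ext _ _ _ fun q j _ => ?_
      rw [Function.update_of_ne (hk i hi), if_neg (hk i hi), ρ.gq_gc]
    · funext i j
      by_cases hi : i ∈ is
      · simp only [hi, hk i hi, if_true, if_false, List.mem_cons, or_true]
        rw [Function.update_of_ne (hk i hi), ρ.gx_gc]
      · by_cases hik : i = k
        · subst hik; simp [hi]
        · simp [hi, hik]
    · funext j
      simp only [List.foldl_cons]
      refine List.foldl_ext _ _ _ fun c i hi => ?_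
      rw [Function.update_of_ne (hk i hi), if_neg (hk i hi)]
    · funext i
      by_cases hi : i ∈ is
      · simp only [hi, if_true, List.mem_cons, or_true]
        rw [Function.update_of_ne (hk i hi)]
        refine List.foldl_ext _ _ _ fun r j _ => ?_
        rw [if_neg (hk i hi), ρ.gr_gc]
      · by_cases hik : i = k
        · subst hik; simp [hi]
        · simp [hi, hik]

/-- The result of a sweep with a local rule. -/
def result (is : List ι) (s : Data ι) : Data ι where
  q := is.foldl (fun q i => is.foldl (fun q j => ρ.gq (s.M i j) (s.C j) (s.R i) q) q) s.q
  M i j := ρ.gx (s.M i j) (s.C j) (s.R i)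
  C j := is.foldl (fun c i => ρ.gc (s.M i j) (s.R i) c) (s.C j)
  R i := is.foldl (fun r j => ρ.gr (s.M i j) (s.C j) r) (s.R i)

theorem computes (is : List ι) (his : is.Nodup) (hmem : ∀ i, i ∈ is) (s : Data ι) :
    MProg.Computes is (MProg.sweep ρ.onView) s (ρ.result is s) (MProg.sweepTime is.length) := by
  have h := MProg.sweep_computes ρ.onView is his s
  rw [actRows_eq ρ is is his his hmem] at h
  simp only [hmem, if_true] at h
  exact h

end LocalRule

namespace Rules

/-- Start with the finest partition, in which every element is a class. -/
def reset : LocalRule where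
  gq _ _ _ q := q
  gx x _ _ := { x with same := x.diag }
  gc _ _ _ := ⟨true, false, false, false, false, false, false⟩
  gr _ _ _ := ⟨true, false, false, false, false, false, false⟩
  gq_gc _ _ _ _ _ := rfl
  gq_gr _ _ _ _ _ := rfl
  gx_gc _ _ _ _ _ := rfl
  gx_gr _ _ _ _ _ := rfl
  gc_gr _ _ _ _ _ := rfl
  gr_gc _ _ _ _ _ := rfl

/-- Clear all marks except for the pivot and the elements that have not been pivots. -/
def clear : LocalRule where
  gq _ _ _ q := q
  gx x _ _ := x
  gc _ _ c := ⟨c.todo, c.pivot, false, false, false, false, false⟩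
  gr _ _ r := ⟨r.todo, r.pivot, false, false, false, false, false⟩
  gq_gc _ _ _ _ _ := rfl
  gq_gr _ _ _ _ _ := rfl
  gx_gc _ _ _ _ _ := rfl
  gx_gr _ _ _ _ _ := rfl
  gc_gr _ _ _ _ _ := rfl
  gr_gc _ _ _ _ _ := rfl

/-- Select the class of the pivot. -/
def load : LocalRule where
  gq _ _ _ q := q
  gx x _ _ := x
  gc x r c := { c with sel := c.sel || (r.pivot && x.same) }
  gr x c r := { r with sel := r.sel || (c.pivot && x.same) }
  gq_gc _ _ _ _ _ := rfl
  gq_gr _ _ _ _ _ := rfl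
  gx_gc _ _ _ _ _ := rfl
  gx_gr _ _ _ _ _ := rfl
  gc_gr _ _ _ _ _ := rfl
  gr_gc _ _ _ _ _ := rfl

/-- Mark the elements for which some label to or from the selected class lacks `s` or `t`. -/
def mark (s t : Atom) : LocalRule where
  gq _ _ _ q := q
  gx x _ _ := x
  gc x r c := { c with
    lackS := c.lackS || (r.sel && decide (s ∉ x.lab))
    lackT := c.lackT || (r.sel && decide (t ∉ x.lab)) }
  gr x c r := { r with
    lackS := r.lackS || (c.sel && decide (s ∉ x.lab))
    lackT := r.lackT || (c.sel && decide (t ∉ x.lab)) }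
  gq_gc _ _ _ _ _ := rfl
  gq_gr _ _ _ _ _ := rfl
  gx_gc _ _ _ _ _ := rfl
  gx_gr _ _ _ _ _ := rfl
  gc_gr _ _ _ _ _ := rfl
  gr_gc _ _ _ _ _ := rfl

/-- Spread the marks over the classes. -/
def spread : LocalRule where
  gq _ _ _ q := q
  gx x _ _ := x
  gc x r c := { c with
    classS := c.classS || (x.same && r.lackS)
    classT := c.classT || (x.same && r.lackT) }
  gr x c r := { r with
    classS := r.classS || (x.same && c.lackS)
    classT := r.classT || (x.same && c.lackT) }
  gq_gc _ _ _ _ _ := rfl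
  gq_gr _ _ _ _ _ := rfl
  gx_gc _ _ _ _ _ := rfl
  gx_gr _ _ _ _ _ := rfl
  gc_gr _ _ _ _ _ := rfl
  gr_gc _ _ _ _ _ := rfl

/-- Select the classes that have both marks. -/
def select : LocalRule where
  gq _ _ _ q := q
  gx x _ _ := x
  gc x r c := { c with
    sel := c.sel || (x.diag && ((c.classS || r.classS) && (c.classT || r.classT))) }
  gr x c r := { r with
    sel := r.sel || (x.diag && ((c.classS || r.classS) && (c.classT || r.classT))) }
  gq_gc _ _ _ _ _ := rfl
  gq_gr _ _ _ _ _ := rfl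
  gx_gc _ _ _ _ _ := rfl
  gx_gr _ _ _ _ _ := rfl
  gc_gr _ _ _ _ _ := rfl
  gr_gc _ _ _ _ _ := rfl

/-- Merge the selected classes. -/
def join : LocalRule where
  gq x c r q := { q with changed := q.changed || (!x.same && (r.sel && c.sel)) }
  gx x c r := { x with same := x.same || (r.sel && c.sel) }
  gc _ _ c := c
  gr _ _ r := r
  gq_gc _ _ _ _ _ := rfl
  gq_gr _ _ _ _ _ := rfl
  gx_gc _ _ _ _ _ := rfl
  gx_gr _ _ _ _ _ := rfl
  gc_gr _ _ _ _ _ := rfl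
  gr_gc _ _ _ _ _ := rfl

/-- Forget the labels between different classes. -/
def forget : LocalRule where
  gq x _ _ q := { q with
    relaxed := q.relaxed || (!x.same && decide (x.lab ≠ Finset.univ)) }
  gx x _ _ := { x with lab := if x.same then x.lab else Finset.univ }
  gc _ _ c := c
  gr _ _ r := r
  gq_gc _ _ _ _ _ := rfl
  gq_gr _ _ _ _ _ := rfl
  gx_gc _ _ _ _ _ := rfl
  gx_gr _ _ _ _ _ := rfl
  gc_gr _ _ _ _ _ := rfl
  gr_gc _ _ _ _ _ := rfl

/-- Check whether all labels contain the identity atom. -/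
def check : LocalRule where
  gq x _ _ q := { q with bad := q.bad || decide (Atom.e ∉ x.lab) }
  gx x _ _ := x
  gc _ _ c := c
  gr _ _ r := r
  gq_gc _ _ _ _ _ := rfl
  gq_gr _ _ _ _ _ := rfl
  gx_gc _ _ _ _ _ := rfl
  gx_gr _ _ _ _ _ := rfl
  gc_gr _ _ _ _ _ := rfl
  gr_gc _ _ _ _ _ := rfl

/-- Make the first element that has not been a pivot the new pivot. -/
def pick (w : View) : View :=
  if w.x.diag then
    { w with
      q := { w.q with active := w.q.active || w.c.todo }
      c := { w.c with pivot := w.c.todo && !w.q.active, todo := w.c.todo && w.q.active }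
      r := { w.r with pivot := w.c.todo && !w.q.active } }
  else w

/-- Mark the diagonal, provided that no marks are set. -/
def diagonal (w : View) : View :=
  if !w.r.todo && !w.c.todo then
    { w with
      x := { w.x with diag := true }
      c := { w.c with todo := true }
      r := { w.r with todo := true } }
  else w

end Rules

/-! ### Accumulating marks and flags along lists -/

namespace Rules

variable {κ : Type}

theorem foldl_sel (l : List κ) (b : κ → Bool) (c : Mark) :
    l.foldl (fun c i => { c with sel := c.sel || b i }) c = { c with sel := c.sel || l.any b } := by
  induction l generalizing c with
  | nil => simp
  | cons i l ih => simp [ih, Bool.or_assoc]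

theorem foldl_lack (l : List κ) (b b' : κ → Bool) (c : Mark) :
    l.foldl (fun c i => { c with lackS := c.lackS || b i, lackT := c.lackT || b' i }) c =
      { c with lackS := c.lackS || l.any b, lackT := c.lackT || l.any b' } := by
  induction l generalizing c with
  | nil => simp
  | cons i l ih => simp [ih, Bool.or_assoc]

theorem foldl_class (l : List κ) (b b' : κ → Bool) (c : Mark) :
    l.foldl (fun c i => { c with classS := c.classS || b i, classT := c.classT || b' i }) c =
      { c with classS := c.classS || l.any b, classT := c.classT || l.any b' } := by
  induction l generalizing c with
  | nil => simp
  | cons i l ih => simp [ih, Bool.or_assoc]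

theorem foldl_changed (l : List κ) (b : κ → Bool) (q : Flags) :
    l.foldl (fun q i => { q with changed := q.changed || b i }) q =
      { q with changed := q.changed || l.any b } := by
  induction l generalizing q with
  | nil => simp
  | cons i l ih => simp [ih, Bool.or_assoc]

theorem foldl_relaxed (l : List κ) (b : κ → Bool) (q : Flags) :
    l.foldl (fun q i => { q with relaxed := q.relaxed || b i }) q =
      { q with relaxed := q.relaxed || l.any b } := by
  induction l generalizing q with
  | nil => simp
  | cons i l ih => simp [ih, Bool.or_assoc]

theorem foldl_bad (l : List κ) (b : κ → Bool) (q : Flags) :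
    l.foldl (fun q i => { q with bad := q.bad || b i }) q =
      { q with bad := q.bad || l.any b } := by
  induction l generalizing q with
  | nil => simp
  | cons i l ih => simp [ih, Bool.or_assoc]

theorem foldl_idem (l : List κ) (f : Mark → Mark) (hf : ∀ c, f (f c) = f c) (c : Mark)
    {i : κ} (hi : i ∈ l) : l.foldl (fun c _ => f c) c = f c := by
  have h : ∀ (l : List κ) (c : Mark), l.foldl (fun c _ => f c) (f c) = f c := by
    intro l
    induction l with
    | nil => exact fun _ => rfl
    | cons i l ih => intro c; rw [List.foldl_cons, hf, ih]
  cases l with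
  | nil => simp at hi
  | cons k l => rw [List.foldl_cons, h]

theorem foldl_id (l : List κ) {β : Type} (c : β) : l.foldl (fun c _ => c) c = c := by
  induction l with
  | nil => rfl
  | cons i l ih => exact ih

end Rules

/-! ### One round of merging -/

namespace MProg

variable {ι : Type} {is : List ι} {p p' : MProg} {s s' s'' : Data ι} {n n' : ℕ}

theorem Computes.mono (h : Computes is p s s' n) (hn : n ≤ n') : Computes is p s s' n' :=
  Exec.mono h hn

theorem Computes.seq (h : Computes is p s s' n) (h' : Computes is p' s' s'' n') :
    Computes is (p.seq p') s s'' (n + n') :=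
  Exec.seq h h'

end MProg

namespace Data

variable {ι : Type}

/-- The labels. -/
def lab (s : Data ι) (i j : ι) : Finset Atom := (s.M i j).lab

/-- The relation whose classes have been computed so far. -/
def same (s : Data ι) (i j : ι) : Prop := (s.M i j).same = true

/-- The elements that have not been pivots yet. -/
def todo (s : Data ι) (i : ι) : Prop := (s.C i).todo = true

/-- The diagonal is marked. -/
def IsDiag (s : Data ι) : Prop := ∀ i j, (s.M i j).diag = true ↔ i = j

/-- The pivot is marked in rows and columns. -/
def IsPivot (s : Data ι) (x : ι) : Prop :=
  (∀ i, (s.R i).pivot = true ↔ i = x) ∧ ∀ j, (s.C j).pivot = true ↔ j = x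

end Data

namespace MProg

open Data

/-- Merge the class of the pivot with all classes from which it cannot be separated. -/
def mergeRound (a b : Atom) : MProg :=
  (sweep Rules.clear.onView).seq ((sweep Rules.load.onView).seq
    ((sweep (Rules.mark a b).onView).seq ((sweep Rules.spread.onView).seq
      ((sweep Rules.select.onView).seq (sweep Rules.join.onView)))))

variable {ι : Type} [DecidableEq ι] {is : List ι}

/-- The sweeps select the pivot's class, mark elements with a lacking label to or from it, spread
these marks over classes, add the classes carrying both kinds of marks to the selection, and finally
join the selected elements. -/
theorem mergeRound_computes (his : is.Nodup) (hmem : ∀ i, i ∈ is) (a b : Atom) {s : Data ι}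
    {x : ι} (hd : s.IsDiag) (hx : s.IsPivot x) (hE : Equivalence s.same) :
    ∃ s', Computes is (mergeRound a b) s s' (6 * sweepTime is.length) ∧ s'.lab = s.lab ∧
      s'.IsDiag ∧ s'.IsPivot x ∧ s'.todo = s.todo ∧ s'.same = merge s.lab a b s.same x ∧
      s'.q.active = s.q.active ∧ s'.q.relaxed = s.q.relaxed ∧ s'.q.bad = s.q.bad ∧
      (s'.q.changed = true ↔
        s.q.changed = true ∨ ∃ i j, ¬ s.same i j ∧ merge s.lab a b s.same x i j) := by
  set s₁ := Rules.clear.result is s with h₁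
  set s₂ := Rules.load.result is s₁ with h₂
  set s₃ := (Rules.mark a b).result is s₂ with h₃
  set s₄ := Rules.spread.result is s₃ with h₄
  set s₅ := Rules.select.result is s₄ with h₅
  set s₆ := Rules.join.result is s₅ with h₆
  have hrun : Computes is (mergeRound a b) s s₆ (6 * sweepTime is.length) := by
    refine Computes.mono ((Rules.clear.computes is his hmem s).seq
      ((Rules.load.computes is his hmem s₁).seq (((Rules.mark a b).computes is his hmem s₂).seq
        ((Rules.spread.computes is his hmem s₃).seq ((Rules.select.computes is his hmem s₄).seq
          (Rules.join.computes is his hmem s₅)))))) (by omega)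
  -- the marks after each sweep
  have C1 : ∀ j, s₁.C j = ⟨(s.C j).todo, (s.C j).pivot, false, false, false, false, false⟩ :=
    fun j => Rules.foldl_idem is
      (fun c => (⟨c.todo, c.pivot, false, false, false, false, false⟩ : Mark)) (fun _ => rfl) _
      (hmem j)
  have R1 : ∀ i, s₁.R i = ⟨(s.R i).todo, (s.R i).pivot, false, false, false, false, false⟩ :=
    fun i => Rules.foldl_idem is
      (fun c => (⟨c.todo, c.pivot, false, false, false, false, false⟩ : Mark)) (fun _ => rfl) _
      (hmem i)
  have C2 : ∀ j, s₂.C j = _ := fun j =>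
    Rules.foldl_sel is (fun i => (s₁.R i).pivot && (s₁.M i j).same) (s₁.C j)
  have R2 : ∀ i, s₂.R i = _ := fun i =>
    Rules.foldl_sel is (fun j => (s₁.C j).pivot && (s₁.M i j).same) (s₁.R i)
  have C3 : ∀ j, s₃.C j = _ := fun j =>
    Rules.foldl_lack is (fun i => (s₂.R i).sel && decide (a ∉ (s₂.M i j).lab))
      (fun i => (s₂.R i).sel && decide (b ∉ (s₂.M i j).lab)) (s₂.C j)
  have R3 : ∀ i, s₃.R i = _ := fun i =>
    Rules.foldl_lack is (fun j => (s₂.C j).sel && decide (a ∉ (s₂.M i j).lab))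
      (fun j => (s₂.C j).sel && decide (b ∉ (s₂.M i j).lab)) (s₂.R i)
  have C4 : ∀ j, s₄.C j = _ := fun j =>
    Rules.foldl_class is (fun i => (s₃.M i j).same && (s₃.R i).lackS)
      (fun i => (s₃.M i j).same && (s₃.R i).lackT) (s₃.C j)
  have R4 : ∀ i, s₄.R i = _ := fun i =>
    Rules.foldl_class is (fun j => (s₃.M i j).same && (s₃.C j).lackS)
      (fun j => (s₃.M i j).same && (s₃.C j).lackT) (s₃.R i)
  have C5 : ∀ j, s₅.C j = { s₄.C j with sel := (s₄.C j).sel ||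
      (((s₄.C j).classS || (s₄.R j).classS) && ((s₄.C j).classT || (s₄.R j).classT)) } := by
    intro j
    have hj : s₅.C j = is.foldl (fun c i => { c with sel := c.sel || ((s.M i j).diag &&
        (((s₄.C j).classS || (s₄.R i).classS) && ((s₄.C j).classT || (s₄.R i).classT))) })
        (s₄.C j) := by
      -- The rule reads the class marks of the very mark that it updates, but changes only `sel`, so
      -- their initial values may be used throughout. Only the diagonal cell then contributes.
      have key : ∀ (l : List ι) (c : Mark), c.classS = (s₄.C j).classS →
          c.classT = (s₄.C j).classT →
          l.foldl (fun c i => Rules.select.gc (s₄.M i j) (s₄.R i) c) c =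
          l.foldl (fun c i => { c with sel := c.sel || ((s.M i j).diag &&
            (((s₄.C j).classS || (s₄.R i).classS) && ((s₄.C j).classT || (s₄.R i).classT))) })
            c := by
        intro l
        induction l with
        | nil => exact fun _ _ _ => rfl
        | cons i l ih =>
          intro c h h'
          rw [List.foldl_cons, List.foldl_cons]
          refine (ih (Rules.select.gc (s₄.M i j) (s₄.R i) c) h h').trans ?_
          rw [← h, ← h']
          rfl
      exact key is _ rfl rfl
    rw [hj, Rules.foldl_sel]
    congr 2
    rw [Bool.eq_iff_iff, List.any_eq_true]
    constructor
    · rintro ⟨i, -, h⟩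
      rw [Bool.and_eq_true, hd i j] at h
      obtain ⟨rfl, h⟩ := h
      exact h
    · intro h
      exact ⟨j, hmem j, by rw [Bool.and_eq_true, hd j j]; exact ⟨rfl, h⟩⟩
  have R5 : ∀ j, s₅.R j = { s₄.R j with sel := (s₄.R j).sel ||
      (((s₄.C j).classS || (s₄.R j).classS) && ((s₄.C j).classT || (s₄.R j).classT)) } := by
    intro j
    have hj : s₅.R j = is.foldl (fun c i => { c with sel := c.sel || ((s.M j i).diag &&
        (((s₄.C i).classS || (s₄.R j).classS) && ((s₄.C i).classT || (s₄.R j).classT))) })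
        (s₄.R j) := by
      have key : ∀ (l : List ι) (c : Mark), c.classS = (s₄.R j).classS →
          c.classT = (s₄.R j).classT →
          l.foldl (fun c i => Rules.select.gr (s₄.M j i) (s₄.C i) c) c =
          l.foldl (fun c i => { c with sel := c.sel || ((s.M j i).diag &&
            (((s₄.C i).classS || (s₄.R j).classS) && ((s₄.C i).classT || (s₄.R j).classT))) })
            c := by
        intro l
        induction l with
        | nil => exact fun _ _ _ => rfl
        | cons i l ih =>
          intro c h h'
          rw [List.foldl_cons, List.foldl_cons]
          refine (ih (Rules.select.gr (s₄.M j i) (s₄.C i) c) h h').trans ?_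
          rw [← h, ← h']
          rfl
      exact key is _ rfl rfl
    rw [hj, Rules.foldl_sel]
    congr 2
    rw [Bool.eq_iff_iff, List.any_eq_true]
    constructor
    · rintro ⟨i, -, h⟩
      rw [Bool.and_eq_true, hd j i] at h
      obtain ⟨rfl, h⟩ := h
      exact h
    · intro h
      exact ⟨j, hmem j, by rw [Bool.and_eq_true, hd j j]; exact ⟨rfl, h⟩⟩
  have C6 : ∀ j, s₆.C j = s₅.C j := fun j => Rules.foldl_id is _
  have R6 : ∀ i, s₆.R i = s₅.R i := fun i => Rules.foldl_id is _
  -- their meaning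
  have selC : ∀ j, (s₂.C j).sel = true ↔ s.same x j := by
    intro j
    rw [C2]
    simp only [C1, R1, Bool.false_or, List.any_eq_true, Bool.and_eq_true, hx.1]
    constructor
    · rintro ⟨_, -, rfl, h⟩; exact h
    · exact fun h => ⟨x, hmem x, rfl, h⟩
  have selR : ∀ j, (s₂.R j).sel = true ↔ s.same x j := by
    intro j
    rw [R2]
    simp only [C1, R1, Bool.false_or, List.any_eq_true, Bool.and_eq_true, hx.2]
    constructor
    · rintro ⟨_, -, rfl, h⟩; exact hE.symm h
    · exact fun h => ⟨x, hmem x, rfl, hE.symm h⟩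
  have lackC : ∀ j, ((s₃.C j).lackS = true ↔ ∃ i, s.same x i ∧ a ∉ s.lab i j) ∧
      ((s₃.C j).lackT = true ↔ ∃ i, s.same x i ∧ b ∉ s.lab i j) := by
    intro j
    rw [C3]
    simp only [C2, C1, Bool.false_or, List.any_eq_true, Bool.and_eq_true, selR, hmem, true_and,
      decide_eq_true_eq]
    exact ⟨Iff.rfl, Iff.rfl⟩
  have lackR : ∀ j, ((s₃.R j).lackS = true ↔ ∃ i, s.same x i ∧ a ∉ s.lab j i) ∧
      ((s₃.R j).lackT = true ↔ ∃ i, s.same x i ∧ b ∉ s.lab j i) := by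
    intro j
    rw [R3]
    simp only [R2, R1, Bool.false_or, List.any_eq_true, Bool.and_eq_true, selC, hmem, true_and,
      decide_eq_true_eq]
    exact ⟨Iff.rfl, Iff.rfl⟩
  have classC : ∀ j, ((s₄.C j).classS = true ↔ ∃ k, s.same k j ∧ (s₃.R k).lackS = true) ∧
      ((s₄.C j).classT = true ↔ ∃ k, s.same k j ∧ (s₃.R k).lackT = true) := by
    intro j
    rw [C4]
    simp only [C3, C2, C1, Bool.false_or, List.any_eq_true, Bool.and_eq_true, hmem, true_and]
    exact ⟨Iff.rfl, Iff.rfl⟩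
  have classR : ∀ j, ((s₄.R j).classS = true ↔ ∃ k, s.same j k ∧ (s₃.C k).lackS = true) ∧
      ((s₄.R j).classT = true ↔ ∃ k, s.same j k ∧ (s₃.C k).lackT = true) := by
    intro j
    rw [R4]
    simp only [R3, R2, R1, Bool.false_or, List.any_eq_true, Bool.and_eq_true, hmem, true_and]
    exact ⟨Iff.rfl, Iff.rfl⟩
  -- Column marks record labels from the pivot's class and row marks labels to it. Spreading swaps
  -- rows and columns, so the disjunction of both marks covers the two directions in `Lacks`.
  have blocked : ∀ j, ((((s₄.C j).classS || (s₄.R j).classS) &&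
      ((s₄.C j).classT || (s₄.R j).classT)) = true ↔ Blocked s.lab a b s.same x j) := by
    intro j
    have h : ∀ d, ((∃ k, s.same k j ∧ ∃ i, s.same x i ∧ d ∉ s.lab k i) ∨
        ∃ k, s.same j k ∧ ∃ i, s.same x i ∧ d ∉ s.lab i k) ↔ Lacks s.lab s.same d x j := by
      intro d
      constructor
      · rintro (⟨k, hk, i, hi, h⟩ | ⟨k, hk, i, hi, h⟩)
        · exact ⟨i, k, hi, hE.symm hk, Or.inr h⟩
        · exact ⟨i, k, hi, hk, Or.inl h⟩
      · rintro ⟨i, k, hi, hk, h | h⟩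
        · exact Or.inr ⟨k, hk, i, hi, h⟩
        · exact Or.inl ⟨k, hE.symm hk, i, hi, h⟩
    simp only [Bool.and_eq_true, Bool.or_eq_true, classC, classR, lackC, lackR]
    rw [h, h]
    rfl
  have selC5 : ∀ j, (s₅.C j).sel = true ↔ s.same x j ∨ Blocked s.lab a b s.same x j := by
    intro j
    rw [C5]
    simp only [Bool.or_eq_true (s₄.C j).sel, blocked]
    rw [C4, C3, selC]
  have selR5 : ∀ j, (s₅.R j).sel = true ↔ s.same x j ∨ Blocked s.lab a b s.same x j := by
    intro j
    rw [R5]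
    simp only [Bool.or_eq_true (s₄.R j).sel, blocked]
    rw [R4, R3, selR]
  refine ⟨s₆, hrun, rfl, hd, ⟨fun i => ?_, fun j => ?_⟩, ?_, ?_, ?_⟩
  · rw [R6, R5, R4, R3, R2, R1]; exact hx.1 i
  · rw [C6, C5, C4, C3, C2, C1]; exact hx.2 j
  · funext j
    unfold todo
    rw [C6, C5, C4, C3, C2, C1]
  · funext i j
    refine propext ?_
    change ((s.M i j).same || ((s₅.R i).sel && (s₅.C j).sel)) = true ↔ _
    rw [Bool.or_eq_true, Bool.and_eq_true, selR5, selC5]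
    rfl
  · have hq : s₅.q = s.q := by
      simp only [h₅, h₄, h₃, h₂, h₁, LocalRule.result, Rules.select, Rules.spread, Rules.mark,
        Rules.load, Rules.clear, Rules.foldl_id]
    have hq6 : s₆.q = { s₅.q with changed := s₅.q.changed || is.any fun i => is.any fun j =>
        !(s.M i j).same && ((s₅.R i).sel && (s₅.C j).sel) } := by
      change is.foldl (fun q i => is.foldl (fun q j => { q with changed := q.changed ||
        (!(s.M i j).same && ((s₅.R i).sel && (s₅.C j).sel)) }) q) s₅.q = _
      simp only [Rules.foldl_changed]
    rw [hq6, hq]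
    refine ⟨rfl, rfl, rfl, ?_⟩
    simp only [Bool.or_eq_true, List.any_eq_true, Bool.and_eq_true, selR5, selC5, hmem, true_and,
      Bool.not_eq_true']
    refine or_congr Iff.rfl (exists_congr fun i => exists_congr fun j => ?_)
    rw [← Bool.not_eq_true]
    constructor
    · rintro ⟨h, h'⟩; exact ⟨h, Or.inr h'⟩
    · rintro ⟨h, h'⟩; exact ⟨h, h'.resolve_left h⟩

end MProg

/-! ### Choosing pivots, and marking the diagonal -/

namespace Data

variable {ι : Type} [DecidableEq ι] {δ : View → View}

theorem act_eq_self {s : Data ι} {i j : ι} (h : δ (s.view i j) = s.view i j) :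
    s.act δ i j = s := by
  unfold act
  rw [h]
  simp [view]

theorem actRow_eq_self {s : Data ι} {i : ι} {js : List ι}
    (h : ∀ j ∈ js, δ (s.view i j) = s.view i j) : s.actRow δ i js = s := by
  induction js with
  | nil => rfl
  | cons j js ih =>
    change (s.act δ i j).actRow δ i js = s
    rw [act_eq_self (h j List.mem_cons_self), ih fun k hk => h k (List.mem_cons_of_mem _ hk)]

theorem actRow_append (s : Data ι) (i : ι) (js js' : List ι) :
    s.actRow δ i (js ++ js') = (s.actRow δ i js).actRow δ i js' :=
  List.foldl_append

theorem act_pick_M (s : Data ι) (i j : ι) : (s.act Rules.pick i j).M = s.M := by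
  have h : ((Rules.pick (s.view i j)).x) = s.M i j := by
    unfold Rules.pick
    split_ifs <;> rfl
  simp [act, h]

/-- Off the diagonal the choice of a pivot does nothing, so a whole row reduces to its diagonal
cell. -/
theorem actRow_pick (s : Data ι) (hd : s.IsDiag) {i : ι} {js : List ι} (hjs : js.Nodup)
    (hi : i ∈ js) : s.actRow Rules.pick i js = s.act Rules.pick i i := by
  obtain ⟨l, l', rfl⟩ := List.append_of_mem hi
  have hoff : ∀ t : Data ι, t.M = s.M → ∀ j, j ≠ i →
      Rules.pick (t.view i j) = t.view i j := by
    intro t ht j hj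
    have : ¬ (t.view i j).x.diag = true := by
      change ¬ (t.M i j).diag = true
      rw [ht, hd i j]
      exact hj.symm
    unfold Rules.pick
    rw [if_neg this]
  rw [List.nodup_append, List.nodup_cons] at hjs
  rw [actRow_append, actRow_eq_self fun j hj => hoff s rfl j ?_]
  · change (s.act Rules.pick i i).actRow Rules.pick i l' = _
    refine actRow_eq_self fun j hj => hoff _ (act_pick_M s i i) j ?_
    rintro rfl
    exact hjs.2.1.1 hj
  · exact hjs.2.2 j hj i List.mem_cons_self

/-- The result of the choice of a pivot at one element of the diagonal. -/
theorem act_pick (s : Data ι) (hd : s.IsDiag) (i : ι) :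
    s.act Rules.pick i i =
      { q := { s.q with active := s.q.active || (s.C i).todo }
        M := s.M
        C := Function.update s.C i { s.C i with
          pivot := (s.C i).todo && !s.q.active, todo := (s.C i).todo && s.q.active }
        R := Function.update s.R i { s.R i with pivot := (s.C i).todo && !s.q.active } } := by
  have h : (s.view i i).x.diag = true := (hd i i).2 rfl
  unfold act Rules.pick
  rw [if_pos h]
  simp [view]

/-- The result of the choice of a pivot among the elements of `l`. -/
structure Picked (l : List ι) (s s' : Data ι) : Prop where
  M : s'.M = s.M
  relaxed : s'.q.relaxed = s.q.relaxed
  bad : s'.q.bad = s.q.bad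
  C : ∀ i, i ∉ l → s'.C i = s.C i
  R : ∀ i, i ∉ l → s'.R i = s.R i
  of_active : s.q.active = true → s'.q.active = true ∧
    ∀ i ∈ l, (s'.C i).pivot = false ∧ (s'.R i).pivot = false ∧ (s'.todo i ↔ s.todo i)
  of_inactive : s.q.active = false → (s'.q.active = false ∧ ∀ i ∈ l, ¬ s.todo i) ∨
    (s'.q.active = true ∧ ∃ x ∈ l, s.todo x ∧ ∀ i ∈ l, ((s'.C i).pivot = true ↔ i = x) ∧
      ((s'.R i).pivot = true ↔ i = x) ∧ (s'.todo i ↔ s.todo i ∧ i ≠ x))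

/-- The flag `active` tells whether a pivot has been found. Until then the elements passed were not
in `todo`; afterwards the remaining elements merely lose their pivot marks. -/
theorem actRows_pick {js : List ι} (hjs : js.Nodup) (hmem : ∀ i, i ∈ js) (l : List ι)
    (hl : l.Nodup) (s : Data ι) (hd : s.IsDiag) : Picked l s (s.actRows Rules.pick js l) := by
  induction l generalizing s with
  | nil => exact ⟨rfl, rfl, rfl, fun _ _ => rfl, fun _ _ => rfl,
      fun h => ⟨h, by simp⟩, fun h => Or.inl ⟨h, by simp⟩⟩
  | cons k l ih =>
    rw [List.nodup_cons] at hl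
    change Picked (k :: l) s ((s.actRow Rules.pick k js).actRows Rules.pick js l)
    rw [actRow_pick s hd hjs (hmem k)]
    have hd' : (s.act Rules.pick k k).IsDiag := by
      intro i j; rw [act_pick_M]; exact hd i j
    have h := ih hl.2 _ hd'
    revert h
    generalize hs' : (s.act Rules.pick k k).actRows Rules.pick js l = s'
    rw [act_pick s hd k]
    intro h
    have hCk := h.C k hl.1
    have hRk := h.R k hl.1
    have hk : ∀ i ∈ l, i ≠ k := by
      rintro i hi rfl
      exact hl.1 hi
    have htodo : ∀ i ∈ l, (todo { q := { s.q with active := s.q.active || (s.C k).todo }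
                                  M := s.M
                                  C := Function.update s.C k { s.C k with
                                    pivot := (s.C k).todo && !s.q.active
                                    todo := (s.C k).todo && s.q.active }
                                  R := Function.update s.R k { s.R k with
                                    pivot := (s.C k).todo && !s.q.active } } i ↔ s.todo i) := by
      intro i hi
      simp only [todo, Function.update_of_ne (hk i hi)]
    simp only [Function.update_self] at hCk hRk
    refine ⟨h.M, h.relaxed, h.bad, fun i hi => ?_, fun i hi => ?_, fun ha => ?_, fun ha => ?_⟩
    · rw [List.mem_cons, not_or] at hi
      rw [h.C i hi.2]
      exact Function.update_of_ne hi.1 _ _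
    · rw [List.mem_cons, not_or] at hi
      rw [h.R i hi.2]
      exact Function.update_of_ne hi.1 _ _
    · obtain ⟨h1, h2⟩ := h.of_active (by simp [ha])
      refine ⟨h1, fun i hi => ?_⟩
      rw [List.mem_cons] at hi
      rcases hi with rfl | hi
      · simp [todo, hCk, hRk, ha]
      · obtain ⟨h3, h4, h5⟩ := h2 i hi
        exact ⟨h3, h4, h5.trans (htodo i hi)⟩
    · cases hk' : (s.C k).todo with
      | true =>
        obtain ⟨h1, h2⟩ := h.of_active (by simp [hk'])
        refine Or.inr ⟨h1, k, List.mem_cons_self, hk', fun i hi => ?_⟩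
        rw [List.mem_cons] at hi
        rcases hi with rfl | hi
        · simp [todo, hCk, hRk, ha, hk']
        · obtain ⟨h3, h4, h5⟩ := h2 i hi
          simp [h3, h4, hk i hi, h5.trans (htodo i hi)]
      | false =>
        rcases h.of_inactive (by simp [hk', ha]) with ⟨h1, h2⟩ | ⟨h1, x, hx, h2, h3⟩
        · refine Or.inl ⟨h1, fun i hi => ?_⟩
          rw [List.mem_cons] at hi
          rcases hi with rfl | hi
          · simp [todo, hk']
          · exact fun h' => h2 i hi ((htodo i hi).2 h')
        · refine Or.inr ⟨h1, x, List.mem_cons_of_mem _ hx, (htodo x hx).1 h2, fun i hi => ?_⟩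
          rw [List.mem_cons] at hi
          rcases hi with rfl | hi
          · simp [todo, hCk, hRk, hk', (hk x hx).symm]
          · obtain ⟨h4, h5, h6⟩ := h3 i hi
            exact ⟨h4, h5, by rw [h6, htodo i hi]⟩

/-- Each row marks exactly one column, so in row `k` the columns of the earlier rows `l` are taken
and the first free one is `k` itself. Marking the row then blocks its remaining cells. -/
theorem actRows_diagonal {l l' : List ι} (hl : (l ++ l').Nodup) (s : Data ι)
    (hC : ∀ j, (s.C j).todo = true ↔ j ∈ l) (hR : ∀ i, (s.R i).todo = true ↔ i ∈ l)
    (hd : ∀ i j, (s.M i j).diag = true ↔ i = j ∧ i ∈ l) :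
    (s.actRows Rules.diagonal (l ++ l') l').lab = s.lab ∧
      (s.actRows Rules.diagonal (l ++ l') l').q = s.q ∧
      ∀ i j, ((s.actRows Rules.diagonal (l ++ l') l').M i j).diag = true ↔
        i = j ∧ i ∈ l ++ l' := by
  induction l' generalizing l s with
  | nil => exact ⟨rfl, rfl, by simpa [actRows] using hd⟩
  | cons k l' ih =>
    have hk : k ∉ l := by
      rw [List.nodup_append] at hl
      exact fun hk => hl.2.2 k hk k List.mem_cons_self rfl
    have hk' : k ∉ l' := by
      rw [List.nodup_append, List.nodup_cons] at hl
      exact hl.2.1.1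
    have hCk : (s.C k).todo = false := by rw [← Bool.not_eq_true, hC]; exact hk
    have hRk : (s.R k).todo = false := by rw [← Bool.not_eq_true, hR]; exact hk
    have hact : s.act Rules.diagonal k k =
      { q := s.q
        M := Function.update s.M k (Function.update (s.M k) k { s.M k k with diag := true })
        C := Function.update s.C k { s.C k with todo := true }
        R := Function.update s.R k { s.R k with todo := true } } := by
      have h : (!(s.view k k).r.todo && !(s.view k k).c.todo) = true := by
        simp [view, hCk, hRk]
      unfold act Rules.diagonal
      rw [if_pos h]
      simp [view]
    have hrow : s.actRow Rules.diagonal k (l ++ k :: l') = s.act Rules.diagonal k k := by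
      have hpre : s.actRow Rules.diagonal k l = s := by
        refine actRow_eq_self fun j hj => ?_
        have : (s.C j).todo = true := (hC j).2 hj
        simp [Rules.diagonal, view, this]
      rw [actRow_append, hpre]
      change (s.act Rules.diagonal k k).actRow Rules.diagonal k l' = _
      refine actRow_eq_self fun j hj => ?_
      rw [hact]
      simp [Rules.diagonal, view]
    change ((s.actRow Rules.diagonal k (l ++ k :: l')).actRows Rules.diagonal
      (l ++ k :: l') l').lab = _ ∧ ((s.actRow Rules.diagonal k (l ++ k :: l')).actRows
      Rules.diagonal (l ++ k :: l') l').q = _ ∧ ∀ i j, (((s.actRow Rules.diagonal k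
      (l ++ k :: l')).actRows Rules.diagonal (l ++ k :: l') l').M i j).diag = true ↔ _
    rw [hrow, hact]
    rw [List.append_cons] at hl ⊢
    refine (fun ⟨h1, h2, h3⟩ => ⟨Eq.trans h1 ?_, h2, h3⟩ :
      _ ∧ _ ∧ _ → _ ∧ _ ∧ _) (ih hl _ (fun j => ?_) (fun i => ?_) (fun i j => ?_))
    · by_cases hj : j = k
      · subst hj; simp
      · simp [hj, hC]
    · by_cases hi : i = k
      · subst hi; simp
      · simp [hi, hR]
    · by_cases hi : i = k
      · subst hi
        by_cases hj : j = i
        · subst hj; simp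
        · simp [hj, hd, Ne.symm hj]
      · simp [hi, hd]
    · funext i j
      by_cases hi : i = k
      · subst hi
        by_cases hj : j = i
        · subst hj; simp [lab]
        · simp [lab, hj]
      · simp [lab, hi]

end Data

/-! ### The decision procedure -/

namespace MProg

open Data

/-- Change the flags. -/
def setFlags (f : Flags → Flags) : MProg := .block [.load fun v => { v with q := f v.q }]

/-- Choose the next pivot. -/
def pickPivot : MProg := (setFlags fun q => { q with active := false }).seq (sweep Rules.pick)

/-- Merge classes until they form the finest splitting. -/
def mergeLoop (a b : Atom) : MProg :=
  .loop (fun v => v.q.active) ((setFlags fun q => { q with changed := false }).seq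
    ((mergeRound a b).seq (.ite (fun v => v.q.changed) (setFlags id) pickPivot)))

/-- Compute the finest splitting and forget the labels between its classes. -/
def split (a b : Atom) : MProg :=
  (sweep Rules.reset.onView).seq (pickPivot.seq ((mergeLoop a b).seq
    (sweep Rules.forget.onView)))

variable {ι : Type} {is : List ι}

theorem setFlags_computes (f : Flags → Flags) (s : Data ι) :
    Computes is (setFlags f) s { s with q := f s.q } 1 :=
  Exec.block rfl

theorem le_sweepTime (m : ℕ) : 12 ≤ sweepTime m := by
  unfold sweepTime
  have := Nat.one_le_pow 2 (m + 1) (by omega)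
  omega

variable [DecidableEq ι]

theorem pickPivot_computes (his : is.Nodup) (hmem : ∀ i, i ∈ is) (s : Data ι) (hd : s.IsDiag) :
    ∃ s', Computes is pickPivot s s' (sweepTime is.length + 1) ∧ s'.lab = s.lab ∧
      s'.same = s.same ∧ s'.IsDiag ∧ s'.q.relaxed = s.q.relaxed ∧ s'.q.bad = s.q.bad ∧
      ((s'.q.active = false ∧ ∀ i, ¬ s.todo i) ∨ (s'.q.active = true ∧ ∃ x, s.todo x ∧
        s'.IsPivot x ∧ s'.todo = fun i => s.todo i ∧ i ≠ x)) := by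
  have h := actRows_pick his hmem is his { s with q := { s.q with active := false } } hd
  refine ⟨_, Computes.mono ((setFlags_computes _ s).seq (sweep_computes Rules.pick is his _))
    (by omega), ?_, ?_, ?_, h.relaxed, h.bad, ?_⟩
  · unfold Data.lab; rw [h.M]
  · unfold Data.same; rw [h.M]
  · intro i j; rw [h.M]; exact hd i j
  · rcases h.of_inactive rfl with ⟨h1, h2⟩ | ⟨h1, x, -, h2, h3⟩
    · exact Or.inl ⟨h1, fun i => h2 i (hmem i)⟩
    · exact Or.inr ⟨h1, x, h2, ⟨fun i => (h3 i (hmem i)).2.1, fun i => (h3 i (hmem i)).1⟩,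
        funext fun i => propext (h3 i (hmem i)).2.2⟩

variable [Fintype ι]

open Classical in
/-- The number of elements that have not been pivots yet. -/
noncomputable def numTodo (T : ι → Prop) : ℕ := (Finset.univ.filter T).card

theorem numTodo_lt {T : ι → Prop} {x : ι} (hx : T x) :
    numTodo (fun i => T i ∧ i ≠ x) < numTodo T := by
  classical
  refine Finset.card_lt_card (Finset.ssubset_iff_of_subset (fun i hi => ?_) |>.2 ⟨x, ?_, ?_⟩)
  · simp only [Finset.mem_filter, Finset.mem_univ, true_and] at hi ⊢
    exact hi.1
  · simpa using hx
  · simp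

theorem length_eq_card (his : is.Nodup) (hmem : ∀ i, i ∈ is) : is.length = Fintype.card ι := by
  rw [← List.toFinset_card_of_nodup his, ← Finset.card_univ]
  congr
  ext i
  simpa using hmem i

variable [LinearOrder ι]

/-- The measure is the number of unused pivots plus the number of classes. A round that changes
something lowers the second summand; otherwise the pivot is finished, and choosing the next one
lowers the first. An iteration takes at most seven sweeps and a few steps, which an eighth sweep
covers. -/
theorem mergeLoop_computes (his : is.Nodup) (hmem : ∀ i, i ∈ is) (a b : Atom) (μ : ℕ)
    (s : Data ι) (x : ι) (hd : s.IsDiag) (hx : s.IsPivot x) (ha : s.q.active = true)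
    (hinv : MergeInv s.lab a b s.same s.todo x) (hμ : numTodo s.todo + numClasses s.same ≤ μ) :
    ∃ s', Computes is (mergeLoop a b) s s' (8 * sweepTime is.length * (μ + 1) + 1) ∧
      s'.lab = s.lab ∧ s'.IsDiag ∧ s'.q.relaxed = s.q.relaxed ∧ s'.q.bad = s.q.bad ∧
      IsFinestSplitting s.lab a b s'.same := by
  have hT := le_sweepTime is.length
  induction μ using Nat.strong_induction_on generalizing s x with
  | _ μ ih =>
    set s₀ : Data ι := { s with q := { s.q with changed := false } } with hs₀
    obtain ⟨s₁, hrun, hlab, hd₁, hx₁, htodo, hsame, hact, hrel, hbad, hch⟩ :=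
      mergeRound_computes (s := s₀) his hmem a b hd hx hinv.equivalence
    have hlab : s₁.lab = s.lab := hlab
    have htodo : s₁.todo = s.todo := htodo
    have hsame : s₁.same = merge s.lab a b s.same x := hsame
    have hch : s₁.q.changed = true ↔ ∃ i j, ¬ s.same i j ∧ merge s.lab a b s.same x i j := by
      rw [hch]
      simp only [hs₀, Bool.false_eq_true, false_or]
      rfl
    cases hc : s₁.q.changed with
    | true =>
      obtain ⟨i, j, hij, hij'⟩ := hch.1 hc
      have hlt : numClasses s₁.same < numClasses s.same := by
        rw [hsame]
        exact numClasses_lt hinv.equivalence (merge_equivalence hinv.equivalence x)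
          (fun _ _ => merge_le) hij' hij
      obtain ⟨s₂, hrun₂, hlab₂, hd₂, hrel₂, hbad₂, hfin⟩ := ih (μ - 1) (by omega) s₁ x hd₁ hx₁
        (hact.trans ha) (by rw [hlab, hsame, htodo]; exact hinv.merge)
        (by rw [htodo]; omega)
      refine ⟨s₂, Computes.mono (Exec.loop_true ha ((setFlags_computes _ s).seq (hrun.seq
        (Exec.ite_true hc (setFlags_computes id s₁)))) hrun₂) ?_, hlab₂.trans hlab, hd₂,
        hrel₂.trans hrel, hbad₂.trans hbad, hlab ▸ hfin⟩
      obtain ⟨ν, rfl⟩ : ∃ ν, μ = ν + 1 := ⟨μ - 1, by omega⟩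
      rw [Nat.add_sub_cancel]
      nlinarith
    | false =>
      have hforall : ∀ i, Blocked s.lab a b s.same x i → s.same x i := by
        intro i hb
        by_contra hno
        refine Bool.false_ne_true (hc.symm.trans (hch.2 ⟨x, i, hno, ?_⟩))
        exact Or.inr ⟨Or.inl (hinv.equivalence.refl x), Or.inr hb⟩
      have hsame : s₁.same = s.same := hsame.trans (merge_eq_of_forall hinv.equivalence hforall)
      obtain ⟨s₂, hrun₂, hlab₂, hsame₂, hd₂, hrel₂, hbad₂, hpick⟩ :=
        pickPivot_computes his hmem s₁ hd₁
      have hbody := (setFlags_computes (is := is) (fun q => { q with changed := false }) s).seq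
        (hrun.seq (Exec.ite_false (f := fun v => v.q.changed) (p := setFlags id) hc hrun₂))
      rcases hpick with ⟨hact₂, hnone⟩ | ⟨hact₂, y, hy, hpy, htodo₂⟩
      · refine ⟨s₂, Computes.mono (Exec.loop_true ha hbody (Exec.loop_false hact₂)) ?_,
          hlab₂.trans hlab, hd₂, hrel₂.trans hrel, hbad₂.trans hbad, ?_⟩
        · nlinarith
        · rw [hsame₂, hsame]
          exact hinv.isFinestSplitting hforall fun i => by rw [← htodo]; exact hnone i
      · have hlt : numTodo s₂.todo < numTodo s.todo := by
          rw [htodo₂, htodo]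
          exact numTodo_lt (htodo ▸ hy)
        obtain ⟨s₃, hrun₃, hlab₃, hd₃, hrel₃, hbad₃, hfin⟩ := ih (μ - 1) (by omega) s₂ y hd₂ hpy
          hact₂ (by rw [hlab₂, hlab, hsame₂, hsame, htodo₂, htodo]; exact hinv.next hforall y)
          (by rw [hsame₂, hsame]; omega)
        refine ⟨s₃, Computes.mono (Exec.loop_true ha hbody hrun₃) ?_,
          hlab₃.trans (hlab₂.trans hlab), hd₃, hrel₃.trans (hrel₂.trans hrel),
          hbad₃.trans (hbad₂.trans hbad), by rwa [hlab₂, hlab] at hfin⟩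
        obtain ⟨ν, rfl⟩ : ∃ ν, μ = ν + 1 := ⟨μ - 1, by omega⟩
        rw [Nat.add_sub_cancel]
        nlinarith

/-- A bound for the time of a splitting step. -/
def splitTime (m : ℕ) : ℕ := 16 * sweepTime m * (m + 1)

theorem split_computes (his : is.Nodup) (hmem : ∀ i, i ∈ is) (a b : Atom) (s : Data ι)
    (hd : s.IsDiag) :
    ∃ s' P, Computes is (split a b) s s' (splitTime is.length) ∧
      IsFinestSplitting s.lab a b P ∧ s'.lab = relax s.lab P ∧ s'.IsDiag ∧
      s'.q.bad = s.q.bad ∧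
      (s'.q.relaxed = true ↔ s.q.relaxed = true ∨ relax s.lab P ≠ s.lab) := by
  have hT := le_sweepTime is.length
  set s₁ := Rules.reset.result is s with hs₁
  have hrun₁ : Computes is (sweep Rules.reset.onView) s s₁ _ := Rules.reset.computes is his hmem s
  have hq₁ : s₁.q = s.q := by
    simp only [hs₁, LocalRule.result, Rules.reset, Rules.foldl_id]
  have htodo₁ : ∀ i, s₁.todo i := fun i => congrArg Mark.todo (Rules.foldl_idem is
    (fun _ => (⟨true, false, false, false, false, false, false⟩ : Mark)) (fun _ => rfl) (s.C i)
      (hmem i))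
  have hsame₁ : s₁.same = Eq := by
    funext i j
    exact propext (hd i j)
  obtain ⟨s₂, hrun₂, hlab₂, hsame₂, hd₂, hrel₂, hbad₂, hpick⟩ :=
    pickPivot_computes his hmem s₁ hd
  have hmain : ∃ s₃, Computes is (mergeLoop a b) s₂ s₃
      (8 * sweepTime is.length * (2 * is.length + 1) + 1) ∧
      s₃.lab = s.lab ∧ s₃.IsDiag ∧ s₃.q.relaxed = s.q.relaxed ∧ s₃.q.bad = s.q.bad ∧
      IsFinestSplitting s.lab a b s₃.same := by
    rcases hpick with ⟨hact₂, hnone⟩ | ⟨hact₂, x, hx, hpx, htodo₂⟩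
    -- After the reset all elements are candidates, so without a pivot there are no elements at all.
    · have hemp : ∀ _ : ι, False := fun i => hnone i (htodo₁ i)
      refine ⟨s₂, Computes.mono (Exec.loop_false hact₂) (by omega), hlab₂, hd₂,
        hrel₂.trans (by rw [hq₁]), hbad₂.trans (by rw [hq₁]), ?_⟩
      exact ⟨⟨⟨fun i => (hemp i).elim, fun {i} => (hemp i).elim, fun {i} => (hemp i).elim⟩,
        fun i => (hemp i).elim⟩, fun _ _ i => (hemp i).elim⟩
    · have htodo₂ : s₂.todo = fun i => i ≠ x := by
        rw [htodo₂]
        funext i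
        simp [htodo₁]
      -- Both summands of the measure are at most the number of elements.
      obtain ⟨s₃, hrun₃, hlab₃, hd₃, hrel₃, hbad₃, hfin⟩ := mergeLoop_computes his hmem a b
        (2 * is.length) s₂ x hd₂ hpx hact₂
        (by rw [hsame₂, hsame₁, htodo₂]; exact MergeInv.init x) (by
          rw [length_eq_card his hmem]
          have h1 := numClasses_le s₂.same
          have h2 : numTodo s₂.todo ≤ Fintype.card ι := Finset.card_le_univ _
          omega)
      exact ⟨s₃, hrun₃, hlab₃.trans hlab₂, hd₃, hrel₃.trans (hrel₂.trans (by rw [hq₁])),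
        hbad₃.trans (hbad₂.trans (by rw [hq₁])), by rwa [hlab₂] at hfin⟩
  obtain ⟨s₃, hrun₃, hlab₃, hd₃, hrel₃, hbad₃, hfin⟩ := hmain
  have hrelax : ∀ i j, ((Rules.forget.result is s₃).lab i j) = relax s.lab s₃.same i j := by
    intro i j
    rw [← hlab₃]
    unfold relax
    split_ifs with h
    · exact if_pos h
    · exact if_neg h
  have hq : (Rules.forget.result is s₃).q = { s₃.q with
      relaxed := s₃.q.relaxed || is.any fun i => is.any fun j =>
        !(s₃.M i j).same && decide ((s₃.M i j).lab ≠ Finset.univ) } := by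
    change is.foldl (fun q i => is.foldl (fun q j => { q with relaxed := q.relaxed ||
      (!(s₃.M i j).same && decide ((s₃.M i j).lab ≠ Finset.univ)) }) q) s₃.q = _
    simp only [Rules.foldl_relaxed]
  refine ⟨Rules.forget.result is s₃, s₃.same, Computes.mono (hrun₁.seq (hrun₂.seq (hrun₃.seq
    (Rules.forget.computes is his hmem s₃)))) ?_, hfin, funext₂ hrelax, hd₃,
    (by rw [hq, hbad₃]), ?_⟩
  -- With `T` the time of a sweep, the steps sum to `T + (T + 1) + (8 * T * (2 * m + 1) + 1) + T`.
  · unfold splitTime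
    clear_value s₁
    generalize sweepTime is.length = T at hT ⊢
    generalize is.length = m
    clear * - hT
    nlinarith
  · rw [hq, ← hrel₃]
    simp only [Bool.or_eq_true, List.any_eq_true, Bool.and_eq_true, hmem, true_and,
      Bool.not_eq_true', decide_eq_true_eq]
    refine or_congr Iff.rfl ⟨?_, ?_⟩
    · rintro ⟨i, j, h, h'⟩ heq
      have h : ¬ s₃.same i j := (Bool.eq_false_iff.1 h)
      have := congrFun (congrFun heq i) j
      rw [relax, if_neg h, ← hlab₃] at this
      exact h' this.symm
    · intro hne
      obtain ⟨i, hi⟩ := Function.ne_iff.1 hne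
      obtain ⟨j, hj⟩ := Function.ne_iff.1 hi
      unfold relax at hj
      split_ifs at hj with h
      · exact absurd rfl hj
      · rw [← hlab₃] at hj
        exact ⟨i, j, Bool.eq_false_iff.2 h, hj.symm⟩

omit [DecidableEq ι] in
theorem numClasses_relax_le {f : ι → ι → Finset Atom} {a b : Atom} {P : ι → ι → Prop}
    (hP : IsFinestSplitting f a b P) :
    numClasses (Linked f) ≤ numClasses (Linked (relax f P)) := by
  by_cases h : relax f P = f
  · rw [h]
  · exact (hP.toIsSplitting.numClasses_linked_lt h).le

/-- Split the network with each pair of colours. -/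
def splitAll : MProg :=
  (setFlags fun q => { q with relaxed := false }).seq
    ((split .a .b).seq ((split .b .c).seq (split .a .c)))

/-- The three pairs are the complements of single colours, as `colorable_iff_of_relax_eq` requires.
Each splitting preserves colourability and never joins linked components, so a set flag means a
strict gain in their number. -/
theorem splitAll_computes (his : is.Nodup) (hmem : ∀ i, i ∈ is) (s : Data ι) (hd : s.IsDiag) :
    ∃ s', Computes is splitAll s s' (3 * splitTime is.length + 1) ∧ s'.IsDiag ∧
      s'.q.bad = s.q.bad ∧ (Colorable s'.lab ↔ Colorable s.lab) ∧
      (s'.q.relaxed = true → numClasses (Linked s.lab) < numClasses (Linked s'.lab)) ∧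
      (s'.q.relaxed = false → (Colorable s'.lab ↔ ∀ i j, Atom.e ∈ s'.lab i j)) := by
  obtain ⟨s₁, P₁, hrun₁, hP₁, hlab₁, hd₁, hbad₁, hrel₁⟩ :=
    split_computes his hmem .a .b { s with q := { s.q with relaxed := false } } hd
  obtain ⟨s₂, P₂, hrun₂, hP₂, hlab₂, hd₂, hbad₂, hrel₂⟩ := split_computes his hmem .b .c s₁ hd₁
  obtain ⟨s₃, P₃, hrun₃, hP₃, hlab₃, hd₃, hbad₃, hrel₃⟩ := split_computes his hmem .a .c s₂ hd₂
  change IsFinestSplitting s.lab .a .b P₁ at hP₁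
  change s₁.lab = relax s.lab P₁ at hlab₁
  change s₁.q.relaxed = true ↔ false = true ∨ relax s.lab P₁ ≠ s.lab at hrel₁
  rw [← hlab₁] at hrel₁
  rw [← hlab₂, hrel₁] at hrel₂
  rw [← hlab₃, hrel₂] at hrel₃
  have hn₁ := numClasses_relax_le hP₁
  have hn₂ := numClasses_relax_le hP₂
  have hn₃ := numClasses_relax_le hP₃
  rw [← hlab₁] at hn₁
  rw [← hlab₂] at hn₂
  rw [← hlab₃] at hn₃
  refine ⟨s₃, Computes.mono ((setFlags_computes _ s).seq (hrun₁.seq (hrun₂.seq hrun₃)))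
    (by omega), hd₃, hbad₃.trans (hbad₂.trans hbad₁), ?_, fun hch => ?_, fun hch => ?_⟩
  · have hcol₁ : Colorable s₁.lab ↔ Colorable s.lab := by
      rw [hlab₁]
      exact ⟨hP₁.toIsSplitting.colorable (by decide) (by decide), Colorable.relax⟩
    have hcol₂ : Colorable s₂.lab ↔ Colorable s₁.lab := by
      rw [hlab₂]
      exact ⟨hP₂.toIsSplitting.colorable (by decide) (by decide), Colorable.relax⟩
    have hcol₃ : Colorable s₃.lab ↔ Colorable s₂.lab := by
      rw [hlab₃]
      exact ⟨hP₃.toIsSplitting.colorable (by decide) (by decide), Colorable.relax⟩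
    exact hcol₃.trans (hcol₂.trans hcol₁)
  · rcases hrel₃.1 hch with ((h | h) | h) | h
    · exact absurd h Bool.false_ne_true
    · have := hP₁.toIsSplitting.numClasses_linked_lt (hlab₁ ▸ h)
      rw [← hlab₁] at this
      omega
    · have := hP₂.toIsSplitting.numClasses_linked_lt (hlab₂ ▸ h)
      rw [← hlab₂] at this
      omega
    · have := hP₃.toIsSplitting.numClasses_linked_lt (hlab₃ ▸ h)
      rw [← hlab₃] at this
      omega
  · rw [← Bool.not_eq_true, hrel₃, not_or, not_or, not_or, not_not, not_not, not_not] at hch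
    obtain ⟨⟨⟨-, h1⟩, h2⟩, h3⟩ := hch
    rw [h1] at hlab₁
    rw [h2] at hlab₂
    rw [h3] at hlab₃
    -- Nothing was discarded, so all three splittings are finest splittings of one and the same
    -- network.
    rw [h3, h2, h1]
    rw [h2, h1] at hP₃ hlab₃
    rw [h1] at hP₂ hlab₂
    refine colorable_iff_of_relax_eq fun c hc => ?_
    cases c
    · exact absurd rfl hc
    · exact ⟨.b, .c, P₂, by decide, by decide, by decide, by decide, by decide, hP₂, hlab₂.symm⟩
    · exact ⟨.a, .c, P₃, by decide, by decide, by decide, by decide, by decide, hP₃, hlab₃.symm⟩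
    · exact ⟨.a, .b, P₁, by decide, by decide, by decide, by decide, by decide, hP₁, hlab₁.symm⟩

/-- Split the network as long as possible. -/
def splitLoop : MProg := .loop (fun v => v.q.relaxed) splitAll

/-- Here `ν` bounds how many linked components can still be gained; every pass that leaves the flag
set gains at least one. -/
theorem splitLoop_computes (his : is.Nodup) (hmem : ∀ i, i ∈ is) (ν : ℕ) (s : Data ι)
    (hd : s.IsDiag) (hrel : s.q.relaxed = true)
    (hν : is.length ≤ numClasses (Linked s.lab) + ν) :
    ∃ s', Computes is splitLoop s s' (4 * splitTime is.length * (ν + 1) + 1) ∧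
      s'.q.bad = s.q.bad ∧ (Colorable s.lab ↔ ∀ i j, Atom.e ∈ s'.lab i j) := by
  have hT : 3 ≤ splitTime is.length := by
    have h := le_sweepTime is.length
    unfold splitTime
    exact le_trans (by omega : 3 ≤ 16 * sweepTime is.length) (Nat.le_mul_of_pos_right _ (by omega))
  induction ν using Nat.strong_induction_on generalizing s with
  | _ ν ih =>
    obtain ⟨s₁, hrun₁, hd₁, hbad₁, hcol₁, hlt, hfixed⟩ := splitAll_computes his hmem s hd
    cases hch : s₁.q.relaxed with
    | true =>
      have hlt := hlt hch
      have hle := numClasses_le (Linked s₁.lab)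
      rw [← length_eq_card his hmem] at hle
      obtain ⟨s₂, hrun₂, hbad₂, h₂⟩ := ih (ν - 1) (by omega) s₁ hd₁ hch (by omega)
      refine ⟨s₂, Computes.mono (Exec.loop_true hrel hrun₁ hrun₂) ?_, hbad₂.trans hbad₁,
        hcol₁.symm.trans h₂⟩
      obtain ⟨ν, rfl⟩ : ∃ ν', ν = ν' + 1 := ⟨ν - 1, by omega⟩
      rw [Nat.add_sub_cancel]
      generalize splitTime is.length = T at hT
      clear * - hT
      nlinarith
    | false =>
      refine ⟨s₁, Computes.mono (Exec.loop_true hrel hrun₁ (Exec.loop_false hch)) ?_, hbad₁,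
        hcol₁.symm.trans (hfixed hch)⟩
      generalize splitTime is.length = T at hT
      clear * - hT
      nlinarith

/-- Decide whether there is a colouring. -/
def solve : MProg :=
  (sweep Rules.diagonal).seq ((setFlags fun q => { q with relaxed := true }).seq
    (splitLoop.seq (sweep Rules.check.onView)))

/-- A bound for the time of the decision procedure. -/
def solveTime (m : ℕ) : ℕ := 5 * splitTime m * (m + 1)

theorem solve_computes (his : is.Nodup) (hmem : ∀ i, i ∈ is) (s : Data ι)
    (hC : ∀ i, s.C i = default) (hR : ∀ i, s.R i = default)
    (hM : ∀ i j, (s.M i j).diag = false) (hq : s.q.bad = false) :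
    ∃ s', Computes is solve s s' (solveTime is.length) ∧
      (s'.q.bad = false ↔ Colorable s.lab) := by
  have hT := le_sweepTime is.length
  obtain ⟨h1, h2, h3⟩ := actRows_diagonal (l := []) (l' := is) his s
    (by simp [hC, default]) (by simp [hR, default]) (by simp [hM])
  rw [List.nil_append] at h1 h2 h3
  have hrun₁ := sweep_computes Rules.diagonal is his s
  revert h1 h2 h3 hrun₁
  generalize s.actRows Rules.diagonal is is = s₁
  intro h1 h2 h3 hrun₁
  -- There are at most as many linked components as variables, so the number of variables serves as
  -- `ν`. The flag is set beforehand so that the loop is entered.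
  obtain ⟨s₂, hrun₂, hbad₂, h₂⟩ := splitLoop_computes his hmem is.length
    { s₁ with q := { s₁.q with relaxed := true } } (fun i j => by simpa [hmem] using h3 i j) rfl
    (by omega)
  have hq' : (Rules.check.result is s₂).q = { s₂.q with
      bad := s₂.q.bad || is.any fun i => is.any fun j =>
        decide (Atom.e ∉ (s₂.M i j).lab) } := by
    change is.foldl (fun q i => is.foldl (fun q j =>
      { q with bad := q.bad || decide (Atom.e ∉ (s₂.M i j).lab) }) q) s₂.q = _
    simp only [Rules.foldl_bad]
  refine ⟨_, Computes.mono (hrun₁.seq ((setFlags_computes _ s₁).seq (hrun₂.seq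
    (Rules.check.computes is his hmem s₂)))) ?_, ?_⟩
  · unfold solveTime splitTime
    generalize sweepTime is.length = T at hT
    generalize is.length = m
    have h : 16 * T ≤ 16 * T * ((m + 1) * (m + 1)) :=
      Nat.le_mul_of_pos_right _ (Nat.mul_pos (by omega) (by omega))
    clear * - hT h
    nlinarith
  · have h₂ : Colorable s.lab ↔ ∀ i j, Atom.e ∈ s₂.lab i j := by rw [← h1]; exact h₂
    have hb : s₂.q.bad = false := by rw [hbad₂]; exact (congrArg Flags.bad h2).trans hq
    rw [hq', h₂]
    simp [hb, hmem, Data.lab]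

end MProg

/-! ### The machine -/

namespace MProg

open Prog StackOp Data

/-- Copy the input to the matrix, one mark per row and column. -/
def readLoop : MProg :=
  .loop (fun v => v.inp.isSome) (.ite (fun v => v.inp.join.isSome)
    (.block [.load fun v => { v with x := some ⟨v.inp.join.getD ∅, false, false⟩ }, pushM',
      .load fun v => { v with x := none }, popInp])
    (.block [pushC, pushR, popInp]))

/-- Read the input. -/
def readInput : MProg := (Prog.block [popInp]).seq (readLoop.seq rewindM)

/-- Empty the stack of the matrix. -/
def clearM : MProg := (Prog.block [popM]).seq (.loop (fun v => v.x.isSome) (.block [popM]))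

/-- Empty the stack of the columns. -/
def clearC : MProg := (Prog.block [popC]).seq (.loop (fun v => v.c.isSome) (.block [popC]))

/-- Empty the stack of the rows. -/
def clearR : MProg := (Prog.block [popR]).seq (.loop (fun v => v.r.isSome) (.block [popR]))

/-- The initial store. -/
def initialStore : Store := ⟨default, none, none, none, none⟩

/-- Write the answer and return to the initial store. -/
def answer : MProg := .block [.push .out fun v => !v.q.bad, .load fun _ => initialStore]

/-- Decide whether the network on the input stack is satisfiable. -/
def decideNetwork : MProg :=
  readInput.seq (solve.seq (clearM.seq (clearC.seq (clearR.seq answer))))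

/-- The initial cell for a label. -/
def labelCell (X : Finset Atom) : Cell := ⟨X, false, false⟩

/-- Each end-of-row marker yields one column mark and one row mark, so the machine obtains the
number of variables in unary. The loop test, the branch and the block cost three steps per symbol.
-/
theorem readLoop_exec (w : List (Option (Finset Atom))) (l : List Cell) (k : ℕ) :
    Exec readLoop { initialStore with inp := w.head? }
      { inp := w.tail, m' := l, c := List.replicate k default, r := List.replicate k default }
      initialStore
      { m' := (w.reduceOption.map labelCell).reverse ++ l
        c := List.replicate (k + w.count none) default
        r := List.replicate (k + w.count none) default } (3 * w.length + 1) := by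
  induction w generalizing l k with
  | nil => exact Exec.loop_false rfl
  | cons y w ih =>
    cases y with
    | none =>
      have h := ih l (k + 1)
      have hk : k + List.count none (none :: w) = k + 1 + List.count none w := by
        rw [List.count_cons_self]
        omega
      rw [hk, List.reduceOption_cons_of_none]
      refine Exec.mono (Exec.loop_true rfl (Exec.ite_false rfl (Exec.block ?_)) h)
        (by rw [List.length_cons]; omega)
      rw [runList_pushC, runList_pushR, runList_popInp, runList_nil]
      rfl
    | some X =>
      have h := ih (labelCell X :: l) k
      have hk : List.count none (some X :: w) = List.count none w :=
        List.count_cons_of_ne (Option.some_ne_none X)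
      rw [hk, List.reduceOption_cons_of_some, List.map_cons, List.reverse_cons,
        List.append_assoc]
      refine Exec.mono (Exec.loop_true rfl (Exec.ite_true rfl (Exec.block ?_)) h)
        (by rw [List.length_cons]; omega)
      rw [runList_load, runList_pushM', runList_load, runList_popInp, runList_nil]
      rfl

theorem readInput_exec (w : List (Option (Finset Atom))) :
    Exec readInput initialStore { inp := w } initialStore
      { m := w.reduceOption.map labelCell
        c := List.replicate (w.count none) default
        r := List.replicate (w.count none) default } (5 * w.length + 4) := by
  have h := readLoop_exec w [] 0
  have h' := rewindM_exec initialStore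
    { m' := (w.reduceOption.map labelCell).reverse ++ []
      c := List.replicate (0 + w.count none) default
      r := List.replicate (0 + w.count none) default }
  simp only [List.append_nil, List.length_reverse, List.reverse_reverse, Nat.zero_add,
    List.length_map] at h h'
  have hlen : w.reduceOption.length ≤ w.length := List.reduceOption_length_le w
  refine Exec.mono (Exec.seq (Exec.block ?_) (Exec.seq h h')) (by omega)
  rw [runList_popInp, runList_nil]
  rfl

/-- A halting configuration must have all stacks empty apart from the output, so the working stacks
are emptied at the end. -/
theorem clearM_exec (v : Store) (t : Tapes) :
    Exec clearM v t { v with x := none } { t with m := [] } (2 * t.m.length + 2) := by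
  suffices h : ∀ l : List Cell, Exec (.loop (fun v => v.x.isSome) (.block [popM]))
      { v with x := l.head? } { t with m := l.tail } { v with x := none } { t with m := [] }
      (2 * l.length + 1) by
    refine Exec.mono (Exec.seq (Exec.block ?_) (h t.m)) (by omega)
    rw [runList_popM, runList_nil]
  intro l
  induction l with
  | nil => exact Exec.loop_false rfl
  | cons y l ih =>
    refine Exec.mono (Exec.loop_true rfl (Exec.block ?_) ih) (n := 1 + 1 + (2 * l.length + 1))
      (by rw [List.length_cons]; omega)
    rw [runList_popM, runList_nil]
    rfl

theorem clearC_exec (v : Store) (t : Tapes) :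
    Exec clearC v t { v with c := none } { t with c := [] } (2 * t.c.length + 2) := by
  suffices h : ∀ l : List Mark, Exec (.loop (fun v => v.c.isSome) (.block [popC]))
      { v with c := l.head? } { t with c := l.tail } { v with c := none } { t with c := [] }
      (2 * l.length + 1) by
    refine Exec.mono (Exec.seq (Exec.block ?_) (h t.c)) (by omega)
    rw [runList_popC, runList_nil]
  intro l
  induction l with
  | nil => exact Exec.loop_false rfl
  | cons y l ih =>
    refine Exec.mono (Exec.loop_true rfl (Exec.block ?_) ih) (n := 1 + 1 + (2 * l.length + 1))
      (by rw [List.length_cons]; omega)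
    rw [runList_popC, runList_nil]
    rfl

theorem clearR_exec (v : Store) (t : Tapes) :
    Exec clearR v t { v with r := none } { t with r := [] } (2 * t.r.length + 2) := by
  suffices h : ∀ l : List Mark, Exec (.loop (fun v => v.r.isSome) (.block [popR]))
      { v with r := l.head? } { t with r := l.tail } { v with r := none } { t with r := [] }
      (2 * l.length + 1) by
    refine Exec.mono (Exec.seq (Exec.block ?_) (h t.r)) (by omega)
    rw [runList_popR, runList_nil]
  intro l
  induction l with
  | nil => exact Exec.loop_false rfl
  | cons y l ih =>
    refine Exec.mono (Exec.loop_true rfl (Exec.block ?_) ih) (n := 1 + 1 + (2 * l.length + 1))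
      (by rw [List.length_cons]; omega)
    rw [runList_popR, runList_nil]
    rfl

end MProg

/-- The initial data for a network. -/
def Network.data (N : Network (Finset Atom)) : Data (Fin N.size) where
  q := default
  M x y := MProg.labelCell (N.label x y)
  C _ := default
  R _ := default

theorem Network.length_encode {A : Type v} (N : Network A) :
    N.encode.length = N.size * (N.size + 1) := by
  simp [Network.encode, List.length_flatMap]

theorem Network.reduceOption_encode {A : Type v} (N : Network A) :
    N.encode.reduceOption =
      (List.finRange N.size).flatMap fun x => (List.finRange N.size).map (N.label x) := by
  rw [Network.encode, List.reduceOption, List.filterMap_flatMap]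
  refine List.flatMap_congr fun x _ => ?_
  simp [List.filterMap_append, List.filterMap_map]

theorem Network.count_encode (N : Network (Finset Atom)) : N.encode.count none = N.size := by
  rw [Network.encode, List.count_flatMap]
  have h : ∀ x : Fin N.size, ((List.finRange N.size).map fun y => some (N.label x y)).count none
      = 0 := by
    intro x
    rw [List.count_eq_zero]
    simp
  simp [Function.comp_def, List.count_append, h]

/-! ### Correctness and running time of the complete machine -/

namespace MProg

open Prog StackOp Data

theorem readInput_encode (N : Network (Finset Atom)) :
    Exec readInput initialStore { inp := N.encode } initialStore
      (tapes (List.finRange N.size) N.data) (5 * N.encode.length + 4) := by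
  have h := readInput_exec N.encode
  have hm : N.encode.reduceOption.map labelCell =
      (List.finRange N.size).flatMap fun x => (List.finRange N.size).map (N.data.M x) := by
    rw [N.reduceOption_encode, List.map_flatMap]
    simp only [List.map_map]
    rfl
  have hc : List.replicate N.size (default : Mark) =
      (List.finRange N.size).map fun _ => default := by
    rw [List.map_const', List.length_finRange]
  rw [hm, N.count_encode, hc] at h
  exact h

theorem decideNetwork_exec (N : Network (Finset Atom)) :
    Exec decideNetwork initialStore { inp := N.encode } initialStore
      { out := [networkSatisfaction.{u} (Finset Atom) N] } (971 * (N.size + 1) ^ 4) := by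
  set is := List.finRange N.size with his
  have hlen : is.length = N.size := List.length_finRange
  obtain ⟨s, hrun, hs⟩ := solve_computes (is := is) (List.nodup_finRange _) List.mem_finRange
    N.data (fun _ => rfl) (fun _ => rfl) (fun _ _ => rfl) rfl
  have hans : (!s.q.bad) = networkSatisfaction.{u} (Finset Atom) N := by
    rw [Bool.eq_iff_iff, Bool.not_eq_true', hs]
    refine (Network.satisfiable_iff.{u} (N := N)).symm.trans ?_
    simp only [networkSatisfaction, decide_eq_true_eq]
  have hm := clearM_exec ⟨s.q, none, none, none, none⟩ (tapes is s)
  have hc := clearC_exec ⟨s.q, none, none, none, none⟩ { c := is.map s.C, r := is.map s.R }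
  have hr := clearR_exec ⟨s.q, none, none, none, none⟩ { r := is.map s.R }
  have hml : (tapes is s).m.length = N.size * N.size := by
    simp [tapes, List.length_flatMap, hlen]
  rw [hml] at hm
  simp only [List.length_map, hlen] at hc hr
  refine Exec.mono ((readInput_encode N).seq (Exec.seq hrun (hm.seq (hc.seq (hr.seq
    (Exec.block ?_)))))) ?_
  · rw [runList_pushOut, runList_load, runList_nil]
    exact congrArg (fun b => (initialStore, Tapes.get { out := [b] })) hans
  -- Solving takes `5 * 16 * 12 = 960` times `(m + 1) ^ 4` steps; reading, clearing and answering
  -- take `7 * m ^ 2 + 9 * m + 11`, at most `11 * (m + 1) ^ 2`.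
  · rw [hlen, N.length_encode]
    unfold solveTime splitTime sweepTime
    generalize N.size = m
    have h : (m + 1) ^ 2 * 1 ≤ (m + 1) ^ 2 * (m + 1) ^ 2 :=
      Nat.mul_le_mul_left _ (Nat.one_le_pow _ _ (by omega))
    clear * - h
    nlinarith

/-- The machine that decides the network satisfaction problem. -/
noncomputable def networkMachine : FinTM2 where
  K := Stack
  k₀ := .inp
  k₁ := .out
  Γ := Stack.Sym
  Λ := Option decideNetwork.Label
  main := some decideNetwork.entry
  σ := Store
  initialState := initialStore
  Γk₀Fin := inferInstanceAs (Fintype (Option (Finset Atom)))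
  m := decideNetwork.machine

theorem initList_networkMachine (w : List (Option (Finset Atom))) :
    initList networkMachine w =
      ⟨some (some decideNetwork.entry), initialStore, Tapes.get { inp := w }⟩ := by
  refine congrArg (TM2.Cfg.mk _ _) (funext fun k => ?_)
  cases k <;> rfl

theorem haltList_networkMachine (w : List Bool) :
    haltList networkMachine w = ⟨none, initialStore, Tapes.get { out := w }⟩ := by
  refine congrArg (TM2.Cfg.mk _ _) (funext fun k => ?_)
  cases k <;> rfl

theorem stepsTo_networkMachine (N : Network (Finset Atom)) {w : List (Option (Finset Atom))}
    {w' : List Bool} (hw : w = N.encode)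
    (hw' : w' = [networkSatisfaction.{u} (Finset Atom) N]) :
    StepsTo networkMachine.m (initList networkMachine w) (haltList networkMachine w')
      (972 * (2 * N.encode.length + 1) ^ 2) := by
  subst hw hw'
  obtain ⟨k, hk, h⟩ := (decideNetwork_exec.{u} N).machine
  refine ⟨k, hk.trans ?_, (congrArg (fun a => (flip bind (TM2.step networkMachine.m))^[k] (some a))
    (initList_networkMachine _)).trans (h.trans (congrArg some (haltList_networkMachine _).symm))⟩
  rw [N.length_encode]
  generalize N.size = m
  -- This bounds `(m + 1) ^ 2` by `2 * n + 1`, where the summand 1 accounts for the empty network.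
  -- The halting step raises 971 to 972.
  have h1 : (m + 1) ^ 2 ≤ 2 * (m * (m + 1)) + 1 := by nlinarith
  have h2 := Nat.pow_le_pow_left h1 2
  have h3 : 1 ≤ (m + 1) ^ 4 := Nat.one_le_pow _ _ (by omega)
  rw [← pow_mul, show 2 * 2 = 4 from rfl] at h2
  omega

/-- The network satisfaction problem is decided in polynomial time. -/
noncomputable def networkComputable :
    TM2ComputableInPolyTime (Network.encode (A := Finset Atom)) encodeBool
      (networkSatisfaction.{u} (Finset Atom)) where
  tm := networkMachine
  inputAlphabet := Equiv.refl _
  outputAlphabet := Equiv.refl _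
  time := Polynomial.C 972 * (2 * Polynomial.X + 1) ^ 2
  outputsFun N :=
    have h := stepsTo_networkMachine.{u} N (List.map_id N.encode) (List.map_id _)
    { steps := h.choose
      evals_in_steps := h.choose_spec.2
      steps_le_m := by
        refine h.choose_spec.1.trans_eq ?_
        simp }

end MProg

theorem mainTheorem6 :
    InPolyTime (Network.encode (A := Finset Atom)) (networkSatisfaction.{u} (Finset Atom)) ∧
      InQuadraticTime (Network.encode (A := Finset Atom))
        (networkSatisfaction.{u} (Finset Atom)) := by
  refine ⟨⟨MProg.networkComputable⟩, MProg.networkComputable.toTM2ComputableInTime, ?_⟩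
  -- For `n ≥ 1` one has `2 * n + 1 ≤ 3 * n`, whose square gives the factor 9.
  refine Asymptotics.IsBigO.of_bound (972 * 9) (Filter.eventually_atTop.2 ⟨1, fun n hn => ?_⟩)
  have hn : (1 : ℝ) ≤ n := by exact_mod_cast hn
  have htime : (MProg.networkComputable.{u}.toTM2ComputableInTime.time n : ℝ) =
      972 * (2 * (n : ℝ) + 1) ^ 2 := by
    simp [TM2ComputableInPolyTime.toTM2ComputableInTime, MProg.networkComputable]
  rw [htime, Real.norm_of_nonneg (by positivity), Real.norm_of_nonneg (by positivity)]
  nlinarith
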